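/- **Theorem 1 (Law of Large Numbers).** Let $D\ge 1$, let $\mathbb{M}_D$ be the space of complex $D\times D$ matrices with trace norm $\|A\|=\operatorname{Tr}\sqrt{A^*A}$ and Hilbert–Schmidt inner product $\langle A,B\rangle=\operatorname{Tr}(A^*B)$, and let $\mathbb{S}_D$ (resp. $\mathbb{S}_D^\circ$) be the set of positive semi-definite (resp. positive definite) matrices of trace one. For a linear map $\phi:\mathbb{M}_D\to\mathbb{M}_D$ let $\|\phi\|=\sup\{\|\phi(A)\|:\|A\|=1\}$, let $\phi^*$ be its adjoint with respect to $\langle\cdot,\cdot\rangle$, and let $v(\phi)=\inf\{\|\phi(X)\|:X\in\mathbb{S}_D\}$. The map $\phi$ is positive if it maps positive semi-definite matrices to positive semi-definite matrices, and strictly positive if it maps $\mathbb{S}_D$ into the positive definite matrices. Put $\ln 0=-\infty$. Let $(\Omega,\mathcal{F},\mathbb{P})$ be a probability space, $\theta:\Omega\to\Omega$ an ergodic measure-preserving map, and $\varphi_0$ a (Borel measurable) random positive linear map on $\mathbb{M}_D$. Set $\varphi_{n;\omega}=\varphi_{0;\theta^n\omega}$ and $\Phi^{(n)}=\varphi_n\circ\cdots\circ\varphi_1$.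 Assume: 1. almost surely there is $n\ge 1$ such that $\Phi^{(n+k)}$ is strictly positive for all $k\ge 0$; 2. $\mathbb{E}\big|\ln\|\varphi_0^*\|\big|<\infty$ and $\mathbb{E}\big|\ln v(\varphi_0^*)\big|<\infty$. Let $\Lambda_n$ be the spectral radius (Perron–Frobenius eigenvalue) of $\Phi^{(n)}$. Then almost surely, for all sufficiently large $n$, there is a unique $L_n\in\mathbb{S}_D$ with $\Phi^{(n)*}(L_n)=\Lambda_nL_n$, and $L_n\in\mathbb{S}_D^\circ$; there is an $\mathbb{S}_D^\circ$-valued random variable $Z_1$ with $L_n\to Z_1$ almost surely; almost surely $\|\varphi_0^*(Z_1)\|>0$, and $\ln\|\varphi_0^*(Z_1)\|$ is integrable. With the finite number $$l=\mathbb{E}\big[\ln\|\varphi_0^*(Z_1)\|\big]$$ one has $$\lim_{n\to\infty}\ \sup_{X,Y\in\mathbb{S}_D}\Big|\frac1n\ln\langle Y,\Phi^{(n)}(X)\rangle-l\Big|=0\quad\text{almost surely}$$ and $$\lim_{n\to\infty}\frac1n\ln\|\Phi^{(n)}\|=\lim_{n\to\infty}\frac1n\ln\Lambda_n=l\quad\text{almost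 surely}.$$ -/

import Mathlib

open MeasureTheory Filter Topology
open scoped ENNReal ComplexOrder MatrixOrder

namespace PosProd

/-- The `D × D` complex matrices. -/
abbrev Mat (D : ℕ) : Type := Matrix (Fin D) (Fin D) ℂ

/-- The linear operators on the space of `D × D` complex matrices. -/
abbrev SuperOp (D : ℕ) : Type := Module.End ℂ (Mat D)

/-- The Borel sigma-algebra on matrices. -/
noncomputable instance matMeasurableSpace (D : ℕ) : MeasurableSpace (Mat D) := borel (Mat D)

instance matBorelSpace (D : ℕ) : BorelSpace (Mat D) := ⟨rfl⟩

/-- The Borel sigma-algebra of the (finite-dimensional) space of operators on matrices. -/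
noncomputable instance superOpMeasurableSpace (D : ℕ) : MeasurableSpace (SuperOp D) :=
  (borel (Mat D →L[ℂ] Mat D)).comap fun φ => LinearMap.toContinuousLinearMap φ

/-- The trace norm `Tr √(A* A)`. -/
noncomputable def traceNorm {D : ℕ} (A : Mat D) : ℝ :=
  (CFC.sqrt (A.conjTranspose * A)).trace.re

/-- The Hilbert-Schmidt inner product `Tr (A* B)`. -/
noncomputable def hsInner {D : ℕ} (A B : Mat D) : ℂ :=
  (A.conjTranspose * B).trace

/-- The Hilbert-Schmidt adjoint of `φ`; see `hsInner_adj` and `eq_adj`. -/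
noncomputable def adj {D : ℕ} (φ : SuperOp D) : SuperOp D where
  toFun A := Matrix.of fun i j => star (hsInner A (φ (Matrix.single i j 1)))
  map_add' A B := by
    ext i j
    simp [hsInner, Matrix.add_mul]
  map_smul' c A := by
    ext i j
    simp [hsInner]

/-- The defining identity of the adjoint: `⟨A, φ B⟩ = ⟨φ* A, B⟩`. -/
theorem hsInner_adj {D : ℕ} (φ : SuperOp D) (A B : Mat D) :
    hsInner A (φ B) = hsInner (adj φ A) B := by
  have hB : B = ∑ i, ∑ j, B i j • (Matrix.single i j (1 : ℂ) : Mat D) := by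
    conv_lhs => rw [Matrix.matrix_eq_sum_single B]
    simp [Matrix.smul_single]
  conv_lhs => rw [hB]
  simp only [map_sum, map_smul, hsInner, Matrix.mul_sum, Matrix.mul_smul, Matrix.trace_sum,
    Matrix.trace_smul]
  rw [Finset.sum_comm]
  simp only [Matrix.trace, Matrix.diag_apply, Matrix.mul_apply (M := (adj φ A).conjTranspose)]
  refine Finset.sum_congr rfl fun j _ => Finset.sum_congr rfl fun i _ => ?_
  simp [adj, hsInner, Matrix.trace, mul_comm]

/-- The defining identity determines the adjoint. -/
theorem eq_adj {D : ℕ} (φ ψ : SuperOp D)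
    (h : ∀ A B, hsInner A (φ B) = hsInner (ψ A) B) : ψ = adj φ := by
  ext A i j
  have := (h A (Matrix.single i j 1)).symm.trans (hsInner_adj φ A (Matrix.single i j 1))
  exact star_injective (by simpa [hsInner, Matrix.trace_mul_single] using this)

/-- The density matrices: positive semi-definite of trace one. -/
def densities (D : ℕ) : Set (Mat D) :=
  {X | X.PosSemidef ∧ X.trace = 1}

/-- The positive definite density matrices. -/
def faithfulDensities (D : ℕ) : Set (Mat D) :=
  {X | X.PosDef ∧ X.trace = 1}

/-- Positive maps send positive semi-definite matrices to positive semi-definite matrices. -/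
def IsPositiveMap {D : ℕ} (φ : SuperOp D) : Prop :=
  ∀ X : Mat D, X.PosSemidef → (φ X).PosSemidef

/-- Strictly positive maps send density matrices to positive definite matrices. -/
def IsStrictlyPositive {D : ℕ} (φ : SuperOp D) : Prop :=
  ∀ X ∈ densities D, (φ X).PosDef

/-- The operator norm induced by the trace norm. -/
noncomputable def opNorm {D : ℕ} (φ : SuperOp D) : ℝ :=
  sSup {r | ∃ A : Mat D, traceNorm A = 1 ∧ r = traceNorm (φ A)}

/-- `v φ = inf {‖φ X‖ : X a density matrix}`. -/
noncomputable def v {D : ℕ} (φ : SuperOp D) : ℝ :=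
  sInf {r | ∃ X ∈ densities D, r = traceNorm (φ X)}

/-- The spectral radius, as a real number (it is finite: the spectrum is a finite set). -/
noncomputable def specRad {D : ℕ} (φ : SuperOp D) : ℝ :=
  (spectralRadius ℂ φ).toReal

/-- `L` is a left Perron-Frobenius eigenmatrix of `φ`: a density matrix with
`φ* L = Λ L`, where `Λ` is the spectral radius of `φ`. -/
def IsLeftPerronFrobenius {D : ℕ} (φ : SuperOp D) (L : Mat D) : Prop :=
  L ∈ densities D ∧ adj φ L = (specRad φ : ℂ) • L

/-- The logarithm of a nonnegative real number, with `ln 0 = -∞`. -/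
noncomputable def elog (x : ℝ) : EReal := ENNReal.log (ENNReal.ofReal x)

/-- The product `Φ^(n)_ω = φ_{n;ω} ∘ ⋯ ∘ φ_{1;ω}`, where `φ_{k;ω} = φ₀ (θ^k ω)`. -/
noncomputable def prodMap {D : ℕ} {Ω : Type*} (θ : Ω → Ω) (φ₀ : Ω → SuperOp D) :
    ℕ → Ω → SuperOp D
  | 0, _ => LinearMap.id
  | n + 1, ω => φ₀ (θ^[n + 1] ω) ∘ₗ prodMap θ φ₀ n ω

/-- The first time `n ≥ 1` from which on `Φ^(n)_ω` is strictly positive (`⊤` if there is none). -/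
noncomputable def tau {D : ℕ} {Ω : Type*} (θ : Ω → Ω) (φ₀ : Ω → SuperOp D) (ω : Ω) : ℕ∞ :=
  ⨅ (n : ℕ) (_ : 1 ≤ n ∧ ∀ k : ℕ, IsStrictlyPositive (prodMap θ φ₀ (n + k) ω)), (n : ℕ∞)

end PosProd

/-!
The adjoints reverse the order of the factors, `Φ^(n)* = φ₁* ∘ ⋯ ∘ φₙ*`, so that the sets of
normalized images of the density matrices under `Φ^(n)*` decrease with `n`. If a block of the
product maps every density matrix `Y` to a matrix that dominates `δ` times its own trace
(`Spreads δ`), the projective image of the whole product is a convex combination, with weights `δ`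
and `1 - δ`, of a fixed point and of an image under the preceding factors
(`exists_normalize_eq_add`), so the block contracts the diameter by `1 - δ`. Strict positivity and
compactness give one block length `K` and one `δ` for which this happens with positive
probability, and ergodicity makes such blocks recur. Hence the images shrink to a single point
(`exists_isLimitState`). This limit state is a measurable function `Z₀ ω` of the sequence of maps
along the orbit of `ω`; since `Φ^(n)` starts with `φ₁`, the random variable of the theorem is
`Z₁ = Z₀ ∘ θ`. The left Perron-Frobenius matrix `Lₙ` is its own normalized image under `Φ^(n)*`,
so it converges to `Z₁`. For a single strictly positive map the same contraction argument, applied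
to the constant sequence, yields existence and uniqueness of the eigenmatrix
(`exists_isLeftPerronFrobenius_iff`).

The limit states satisfy `φ₀*(Z₁) = ‖φ₀*(Z₁)‖ Z₀`. Iterating, `ln Tr Φ^(n)*(Z₁ ∘ θⁿ)` is a Birkhoff
sum of `ln ‖φ₀*(Z₁)‖`, which lies between `ln v(φ₀*)` and a constant plus `ln ‖φ₀*‖` and is thus
integrable; by the pointwise ergodic theorem (`ae_tendsto_birkhoffAverage`, proved here with the
argument of the maximal ergodic theorem) its averages converge to `l`.

For a general density matrix `Y`, let `m` be the start of the last spreading block before time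
`n`. After this block all information on `Y` except the trace is lost up to the factor `δ`, so
`ln Tr Φ^(n)*(Y)` differs from `ln Tr Φ^(n)*(Z₁ ∘ θⁿ)` by at most a constant plus the sum of the
distortions `ln Tr φⱼ*(1) - ln v(φⱼ*)` over `m ≤ j < n`. The visits to a set of positive measure
have a density, so `m = n - o(n)` (`exists_visit_sequence`), and the ergodic theorem for the
distortions makes this sum `o(n)`. Testing against `X` instead of taking the trace costs another
constant, because an initial block spreads too. This is `exists_uniform_log_rip_bound`; the norm
and the spectral radius of `Φ^(n)` are comparable to such matrix elements.
-/

namespace PosProd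

/-! ### The pointwise ergodic theorem -/

section Ergodic

variable {Ω : Type*} {θ : Ω → Ω}

/-- The maximum `max (S₀ f, …, Sₙ f)` of the Birkhoff sums of `f`, defined through the recursion
`max (S₀, …, Sₙ₊₁) = max (0, f + max (S₀, …, Sₙ) ∘ θ)`. -/
noncomputable def maxSum (θ : Ω → Ω) (f : Ω → ℝ) : ℕ → Ω → ℝ
  | 0, _ => 0
  | n + 1, ω => max 0 (f ω + maxSum θ f n (θ ω))

theorem maxSum_nonneg (f : Ω → ℝ) (n : ℕ) (ω : Ω) : 0 ≤ maxSum θ f n ω := by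
  cases n <;> simp [maxSum]

theorem maxSum_le_succ (f : Ω → ℝ) (n : ℕ) (ω : Ω) : maxSum θ f n ω ≤ maxSum θ f (n + 1) ω := by
  induction n generalizing ω with
  | zero => simp [maxSum]
  | succ n ih =>
    have := ih (θ ω)
    rw [maxSum, maxSum]
    gcongr

theorem birkhoffSum_le_maxSum (f : Ω → ℝ) (n : ℕ) (ω : Ω) :
    birkhoffSum θ f n ω ≤ maxSum θ f n ω := by
  induction n generalizing ω with
  | zero => simp [maxSum]
  | succ n ih =>
    rw [birkhoffSum_succ', maxSum]
    exact le_max_of_le_right (by gcongr; exact ih _)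

theorem bddAbove_birkhoffSum_comp_iff (f : Ω → ℝ) (ω : Ω) :
    BddAbove (Set.range fun n => birkhoffSum θ f n (θ ω)) ↔
      BddAbove (Set.range fun n => birkhoffSum θ f n ω) := by
  constructor
  · rintro ⟨B, hB⟩
    refine ⟨max 0 (f ω + B), ?_⟩
    rintro _ ⟨n, rfl⟩
    cases n with
    | zero => simp
    | succ n =>
      have : birkhoffSum θ f n (θ ω) ≤ B := hB ⟨n, rfl⟩
      simp only [birkhoffSum_succ']
      exact le_max_of_le_right (by linarith)
  · rintro ⟨B, hB⟩
    refine ⟨B - f ω, ?_⟩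
    rintro _ ⟨n, rfl⟩
    have : birkhoffSum θ f (n + 1) ω ≤ B := hB ⟨n + 1, rfl⟩
    rw [birkhoffSum_succ'] at this
    linarith

variable [MeasurableSpace Ω] {μ : Measure Ω}

theorem measurable_birkhoffSum (hθ : Measurable θ) {f : Ω → ℝ} (hf : Measurable f) (n : ℕ) :
    Measurable (birkhoffSum θ f n) := by
  exact Finset.measurable_fun_sum _ fun k _ => hf.comp (hθ.iterate k)

theorem measurable_maxSum (hθ : Measurable θ) {f : Ω → ℝ} (hf : Measurable f) (n : ℕ) :
    Measurable (maxSum θ f n) := by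
  induction n with
  | zero => exact measurable_const
  | succ n ih => exact measurable_const.max (hf.add (ih.comp hθ))

theorem integrable_maxSum (hθ : MeasurePreserving θ μ μ) {f : Ω → ℝ}
    (hfi : Integrable f μ) (n : ℕ) : Integrable (maxSum θ f n) μ := by
  induction n with
  | zero => exact integrable_zero _ _ _
  | succ n ih =>
    have := (hfi.add (hθ.integrable_comp_of_integrable ih)).pos_part
    simpa [maxSum, max_comm] using this

/-- The Birkhoff sums of a function of negative mean are almost surely bounded above. Otherwise
they are unbounded almost everywhere, and `∫ f ≥ 0` is the limit of the nonnegative numbers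
`∫ (maxSum (n + 1) - maxSum n ∘ θ) = ∫ max (-maxSum n ∘ θ) f`. -/
theorem ae_bddAbove_birkhoffSum (hθ : Ergodic θ μ) {f : Ω → ℝ} (hf : Measurable f)
    (hfi : Integrable f μ) (hneg : ∫ ω, f ω ∂μ < 0) :
    ∀ᵐ ω ∂μ, BddAbove (Set.range fun n => birkhoffSum θ f n ω) := by
  have hms : MeasurableSet {ω | BddAbove (Set.range fun n => birkhoffSum θ f n ω)} := by
    apply measurableSet_bddAbove_range
    exact fun n => measurable_birkhoffSum hθ.measurable hf n
  have hinv : θ ⁻¹' {ω | BddAbove (Set.range fun n => birkhoffSum θ f n ω)} =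
      {ω | BddAbove (Set.range fun n => birkhoffSum θ f n ω)} := by
    ext ω
    exact bddAbove_birkhoffSum_comp_iff f ω
  rcases hθ.toPreErgodic.ae_mem_or_ae_notMem hms hinv with h | h
  · exact h
  exfalso
  have hlim : Tendsto (fun n => ∫ ω, max (-maxSum θ f n (θ ω)) (f ω) ∂μ) atTop
      (𝓝 (∫ ω, f ω ∂μ)) := by
    refine tendsto_integral_of_dominated_convergence (fun ω => |f ω|) ?_ hfi.abs ?_ ?_
    · exact fun n => ((((measurable_maxSum hθ.measurable hf n).comp hθ.measurable).neg).max
        hf).aestronglyMeasurable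
    · refine fun n => Eventually.of_forall fun ω => ?_
      rw [Real.norm_eq_abs, abs_le]
      have := maxSum_nonneg (θ := θ) f n (θ ω)
      exact ⟨le_max_of_le_right (neg_abs_le _),
        max_le (by linarith [abs_nonneg (f ω)]) (le_abs_self _)⟩
    · filter_upwards [h] with ω hω
      have hω' : ¬ BddAbove (Set.range fun n => birkhoffSum θ f n (θ ω)) := fun hb =>
        hω ((bddAbove_birkhoffSum_comp_iff f ω).1 hb)
      obtain ⟨_, ⟨N, rfl⟩, hN⟩ := not_bddAbove_iff.1 hω' (-f ω)
      refine tendsto_const_nhds.congr' ?_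
      filter_upwards [eventually_ge_atTop N] with n hn
      have h1 : maxSum θ f N (θ ω) ≤ maxSum θ f n (θ ω) :=
        monotone_nat_of_le_succ (f := fun n => maxSum θ f n (θ ω))
          (fun n => maxSum_le_succ f n _) hn
      have h2 := birkhoffSum_le_maxSum (θ := θ) f N (θ ω)
      exact (max_eq_right (by dsimp only at hN; linarith)).symm
  refine absurd (ge_of_tendsto' hlim fun n => ?_) hneg.not_ge
  have h1 : ∀ ω, max (-maxSum θ f n (θ ω)) (f ω) =
      maxSum θ f (n + 1) ω - maxSum θ f n (θ ω) := by
    intro ω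
    rw [maxSum, ← max_sub_sub_right]
    simp
  have hi := integrable_maxSum hθ.toMeasurePreserving hfi
  have hcomp : ∫ ω, maxSum θ f n (θ ω) ∂μ = ∫ ω, maxSum θ f n ω ∂μ := by
    have := integral_map (μ := μ) hθ.measurable.aemeasurable
      (f := maxSum θ f n) (by rw [hθ.map_eq]; exact (hi n).aestronglyMeasurable)
    rw [hθ.map_eq] at this
    exact this.symm
  simp_rw [h1]
  have hi' : Integrable (fun ω => maxSum θ f n (θ ω)) μ :=
    hθ.toMeasurePreserving.integrable_comp_of_integrable (hi n)
  rw [integral_sub (hi _) hi', hcomp, sub_nonneg]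
  exact integral_mono (hi _) (hi _) fun ω => maxSum_le_succ f n ω

theorem ae_eventually_birkhoffAverage_lt [IsProbabilityMeasure μ] (hθ : Ergodic θ μ) {f : Ω → ℝ}
    (hf : Measurable f) (hfi : Integrable f μ) {c : ℝ} (hc : ∫ ω, f ω ∂μ < c) :
    ∀ᵐ ω ∂μ, ∀ᶠ n in atTop, birkhoffAverage ℝ θ f n ω < c := by
  obtain ⟨d, hd, hdc⟩ := exists_between hc
  have := ae_bddAbove_birkhoffSum hθ (f := fun ω => f ω - d) (hf.sub_const d)
    (hfi.sub (integrable_const d))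
    (by rw [integral_sub hfi (integrable_const d)]; simpa using hd)
  filter_upwards [this] with ω ⟨B, hB⟩
  have hlim : Tendsto (fun n : ℕ => B / (n : ℝ) + d) atTop (𝓝 (0 + d)) :=
    (tendsto_const_div_atTop_nhds_zero_nat B).add_const d
  rw [zero_add] at hlim
  filter_upwards [hlim.eventually_lt_const hdc, eventually_gt_atTop 0] with n hn hn0
  refine lt_of_le_of_lt ?_ hn
  have hn0' : (0 : ℝ) < n := by exact_mod_cast hn0
  have h1 : birkhoffSum θ (fun ω => f ω - d) n ω ≤ B := hB ⟨n, rfl⟩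
  have h2 : birkhoffSum θ (fun ω => f ω - d) n ω = birkhoffSum θ f n ω - n * d := by
    simp [birkhoffSum]
  rw [birkhoffAverage, smul_eq_mul, inv_mul_le_iff₀ hn0', mul_add, mul_div_cancel₀ _ hn0'.ne']
  linarith

/-- **Birkhoff's pointwise ergodic theorem**, for an ergodic map. -/
theorem ae_tendsto_birkhoffAverage [IsProbabilityMeasure μ] (hθ : Ergodic θ μ) {f : Ω → ℝ}
    (hf : Measurable f) (hfi : Integrable f μ) :
    ∀ᵐ ω ∂μ, Tendsto (fun n => birkhoffAverage ℝ θ f n ω) atTop (𝓝 (∫ ω, f ω ∂μ)) := by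
  have key : ∀ g : Ω → ℝ, Measurable g → Integrable g μ → ∀ᵐ ω ∂μ, ∀ k : ℕ, ∀ᶠ n in atTop,
      birkhoffAverage ℝ θ g n ω < ∫ ω, g ω ∂μ + 1 / ((k : ℝ) + 1) := fun g hg hgi =>
    ae_all_iff.2 fun k => ae_eventually_birkhoffAverage_lt hθ hg hgi
      (lt_add_of_pos_right _ Nat.one_div_pos_of_nat)
  filter_upwards [key f hf hfi, key (fun ω => -f ω) hf.neg hfi.neg] with ω h1 h2
  refine Metric.tendsto_atTop'.2 fun ε hε => ?_
  obtain ⟨k, hk⟩ := exists_nat_one_div_lt hε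
  obtain ⟨N, hN⟩ := eventually_atTop.1 ((h1 k).and (h2 k))
  refine ⟨N, fun n hn => ?_⟩
  obtain ⟨h3, h4⟩ := hN n hn.le
  have h5 : birkhoffAverage ℝ θ (fun ω => -f ω) n ω = -birkhoffAverage ℝ θ f n ω := by
    simp [birkhoffAverage, birkhoffSum]
  rw [h5, integral_neg] at h4
  rw [Real.dist_eq, abs_lt]
  constructor <;> linarith

/-- If the visits of a sequence to a property have a positive density, the last visit before time
`n - K` happens at a time `n - o(n)`. -/
theorem exists_visit_sequence {P : ℕ → Prop} [DecidablePred P] {p : ℝ} (hp : 0 < p)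
    (h : Tendsto (fun n : ℕ => (Nat.count P n : ℝ) / n) atTop (𝓝 p)) (K : ℕ) :
    ∃ m : ℕ → ℕ, (∀ᶠ n in atTop, m n + K ≤ n ∧ P (m n)) ∧
      Tendsto (fun n => (m n : ℝ) / n) atTop (𝓝 1) := by
  have hcount : Tendsto (fun n => Nat.count P n) atTop atTop := by
    have : Tendsto (fun n : ℕ => (Nat.count P n : ℝ) / n * n) atTop atTop :=
      h.pos_mul_atTop hp tendsto_natCast_atTop_atTop
    refine tendsto_natCast_atTop_iff.1 (this.congr' ?_)
    filter_upwards [eventually_gt_atTop 0] with n hn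
    have : (n : ℝ) ≠ 0 := by exact_mod_cast hn.ne'
    field_simp
  have hsub : Tendsto (fun n => n - K + 1) atTop atTop :=
    (tendsto_add_atTop_nat 1).comp (tendsto_sub_atTop_nat K)
  set m : ℕ → ℕ := fun n => Nat.findGreatest P (n - K) with hm
  have hmP : ∀ᶠ n in atTop, P (m n) := by
    filter_upwards [(hcount.comp hsub).eventually_gt_atTop 0] with n hn
    obtain ⟨k, hk, hPk⟩ : ∃ k, k < n - K + 1 ∧ P k := by
      by_contra! hcon
      have : Nat.count P (n - K + 1) = 0 := by
        rw [Nat.count_eq_card_filter_range, Finset.card_eq_zero, Finset.filter_eq_empty_iff]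
        intro k hk
        exact hcon k (Finset.mem_range.1 hk)
      simp only [Function.comp_apply] at hn
      omega
    exact Nat.findGreatest_spec (P := P) (Nat.lt_succ_iff.1 hk) hPk
  have hmc : ∀ n, Nat.count P (m n + 1) = Nat.count P (n - K + 1) := by
    intro n
    have hle : m n ≤ n - K := Nat.findGreatest_le _
    obtain ⟨d, hd⟩ := Nat.exists_eq_add_of_le hle
    rw [show n - K + 1 = (m n + 1) + d by omega, Nat.count_add _ (m n + 1)]
    have : Nat.count (fun k => P (m n + 1 + k)) d = 0 := by
      rw [Nat.count_eq_card_filter_range, Finset.card_eq_zero, Finset.filter_eq_empty_iff]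
      intro k hk
      have := Finset.mem_range.1 hk
      exact Nat.findGreatest_is_greatest (n := n - K) (k := m n + 1 + k)
        (by simp only [hm] at *; omega) (by omega)
    omega
  have hmt : Tendsto (fun n => m n + 1) atTop atTop := by
    refine tendsto_atTop_mono (fun n => ?_) (hcount.comp hsub)
    simp only [Function.comp_apply]
    rw [← hmc]
    exact Nat.count_le _
  refine ⟨m, ?_, ?_⟩
  · filter_upwards [hmP, eventually_ge_atTop K] with n hn hK
    exact ⟨by have : m n ≤ n - K := Nat.findGreatest_le _; omega, hn⟩
  · -- `(m n + 1) / n` is the quotient of two frequencies of visits with the same limit `p`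
    have h1 := h.comp hmt
    have h2 := h.comp hsub
    have h3 : Tendsto (fun n : ℕ => ((n - K + 1 : ℕ) : ℝ) / n) atTop (𝓝 1) := by
      have : Tendsto (fun n : ℕ => 1 + (1 - (K : ℝ)) / n) atTop (𝓝 (1 + 0)) :=
        (tendsto_const_div_atTop_nhds_zero_nat _).const_add 1
      rw [add_zero] at this
      refine this.congr' ?_
      filter_upwards [eventually_ge_atTop K, eventually_gt_atTop 0] with n hn hn0
      have : (n : ℝ) ≠ 0 := by exact_mod_cast hn0.ne'
      push_cast [Nat.cast_sub hn]
      field_simp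
      ring
    have h4 : Tendsto (fun n : ℕ => ((m n + 1 : ℕ) : ℝ) / n - 1 / n) atTop (𝓝 (p * 1 / p - 0)) := by
      refine Tendsto.sub ?_ tendsto_one_div_atTop_nhds_zero_nat
      refine ((h2.mul h3).div h1 hp.ne').congr' ?_
      filter_upwards [(hcount.comp hsub).eventually_gt_atTop 0, eventually_gt_atTop 0] with n hn hn0
      simp only [Function.comp_apply, Pi.div_apply] at hn ⊢
      rw [hmc]
      have a1 : (n : ℝ) ≠ 0 := by exact_mod_cast hn0.ne'
      have a2 : ((Nat.count P (n - K + 1) : ℕ) : ℝ) ≠ 0 := by exact_mod_cast hn.ne'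
      have a3 : ((n - K + 1 : ℕ) : ℝ) ≠ 0 := by positivity
      have a4 : ((m n + 1 : ℕ) : ℝ) ≠ 0 := by positivity
      field_simp
    rw [mul_one, div_self hp.ne', sub_zero] at h4
    refine h4.congr fun n => ?_
    push_cast
    ring

/-- Almost every orbit of an ergodic map enters a set of positive measure, and the last entrance
before time `n - K` happens at a time `n - o(n)`. -/
theorem ae_exists_visit_sequence [IsProbabilityMeasure μ] (hθ : Ergodic θ μ) {E : Set Ω}
    (hE : MeasurableSet E) (hE0 : μ E ≠ 0) (K : ℕ) :
    ∀ᵐ ω ∂μ, ∃ m : ℕ → ℕ, (∀ᶠ n in atTop, m n + K ≤ n ∧ θ^[m n] ω ∈ E) ∧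
      Tendsto (fun n => (m n : ℝ) / n) atTop (𝓝 1) := by
  classical
  have hint : Integrable (E.indicator fun _ => (1 : ℝ)) μ := (integrable_const 1).indicator hE
  have hp : 0 < ∫ ω, E.indicator (fun _ => (1 : ℝ)) ω ∂μ := by
    rw [integral_indicator_const _ hE, smul_eq_mul, mul_one]
    exact ENNReal.toReal_pos hE0 (measure_ne_top _ _)
  filter_upwards [ae_tendsto_birkhoffAverage hθ (measurable_const.indicator hE) hint] with ω hω
  refine exists_visit_sequence (P := fun k => θ^[k] ω ∈ E) hp (hω.congr fun n => ?_) K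
  rw [birkhoffAverage, smul_eq_mul, inv_mul_eq_div, Nat.count_eq_card_filter_range,
    Finset.card_filter]
  simp [birkhoffSum, Set.indicator_apply]

end Ergodic

/-! ### Positive matrices, density matrices and the trace norm -/

section Matrices

open Matrix

variable {D : ℕ}

instance matSecondCountableTopology : SecondCountableTopology (Mat D) :=
  inferInstanceAs (SecondCountableTopology (Fin D → Fin D → ℂ))

instance matMetrizableSpace : TopologicalSpace.MetrizableSpace (Mat D) :=
  inferInstanceAs (TopologicalSpace.MetrizableSpace (Fin D → Fin D → ℂ))

theorem continuous_superOp (φ : SuperOp D) : Continuous φ :=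
  LinearMap.continuous_of_finiteDimensional φ

/-- The real part of the trace. On positive semi-definite matrices it is the trace norm. -/
noncomputable def rtr (A : Mat D) : ℝ := A.trace.re

/-- The real part of the Hilbert-Schmidt inner product. -/
noncomputable def rip (A B : Mat D) : ℝ := (hsInner A B).re

@[simp] theorem rtr_zero : rtr (0 : Mat D) = 0 := by simp [rtr]

@[simp] theorem rtr_one : rtr (1 : Mat D) = D := by simp [rtr]

theorem rtr_sub (A B : Mat D) : rtr (A - B) = rtr A - rtr B := by simp [rtr]

theorem rtr_smul (r : ℝ) (A : Mat D) : rtr ((r : ℂ) • A) = r * rtr A := by simp [rtr]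

theorem rip_sub_left (A B X : Mat D) : rip (A - B) X = rip A X - rip B X := by
  simp [rip, hsInner, Matrix.sub_mul]

theorem rip_smul_left (r : ℝ) (A X : Mat D) : rip ((r : ℂ) • A) X = r * rip A X := by
  simp [rip, hsInner]

theorem rip_smul_right (r : ℝ) (A X : Mat D) : rip A ((r : ℂ) • X) = r * rip A X := by
  simp [rip, hsInner]

theorem rip_one_left (X : Mat D) : rip 1 X = rtr X := by simp [rip, rtr, hsInner]

theorem rip_one_right (A : Mat D) : rip A 1 = rtr A := by
  simp [rip, rtr, hsInner, Matrix.trace_conjTranspose]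

theorem hsInner_comm (A B : Mat D) : hsInner B A = star (hsInner A B) := by
  simp [hsInner, ← Matrix.trace_conjTranspose]

theorem rip_comm (A B : Mat D) : rip A B = rip B A := by
  simp [rip, hsInner_comm A B]

theorem rip_adj (φ : SuperOp D) (A B : Mat D) : rip A (φ B) = rip (adj φ A) B := by
  rw [rip, rip, hsInner_adj]

theorem continuous_rtr : Continuous (rtr (D := D)) := by
  unfold rtr
  fun_prop

theorem continuous_rip {α : Type*} [TopologicalSpace α] {f g : α → Mat D} (hf : Continuous f)
    (hg : Continuous g) : Continuous fun x => rip (f x) (g x) := by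
  unfold rip hsInner
  fun_prop

theorem continuous_rip_superOp (φ : SuperOp D) :
    Continuous fun p : Mat D × Mat D => rip (φ p.1) p.2 :=
  continuous_rip ((continuous_superOp φ).comp continuous_fst) continuous_snd

theorem posSemidef_smul {A : Mat D} (hA : A.PosSemidef) {r : ℝ} (hr : 0 ≤ r) :
    ((r : ℂ) • A).PosSemidef :=
  hA.smul (by exact_mod_cast hr)

theorem rtr_nonneg {A : Mat D} (hA : A.PosSemidef) : 0 ≤ rtr A :=
  (Complex.le_def.1 hA.trace_nonneg).1

theorem trace_eq_rtr {A : Mat D} (hA : A.PosSemidef) : A.trace = (rtr A : ℂ) :=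
  Complex.ext rfl (Complex.le_def.1 hA.trace_nonneg).2.symm

theorem rtr_pos_of_ne_zero {A : Mat D} (hA : A.PosSemidef) (h : A ≠ 0) : 0 < rtr A := by
  refine (rtr_nonneg hA).lt_of_ne' fun h0 => h ?_
  rw [← hA.trace_eq_zero_iff, trace_eq_rtr hA, h0, Complex.ofReal_zero]

theorem rip_nonneg {A X : Mat D} (hA : A.PosSemidef) (hX : X.PosSemidef) : 0 ≤ rip A X := by
  obtain ⟨B, rfl⟩ := CStarAlgebra.nonneg_iff_eq_star_mul_self.1 hX.nonneg
  have : hsInner A (star B * B) = (B * A * Bᴴ).trace := by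
    rw [hsInner, hA.1.eq, star_eq_conjTranspose, ← Matrix.mul_assoc, Matrix.trace_mul_comm,
      ← Matrix.mul_assoc]
  rw [rip, this]
  exact rtr_nonneg (hA.mul_mul_conjTranspose_same B)

/-- A positive semi-definite matrix is dominated by its trace. -/
theorem posSemidef_rtr_smul_one_sub {A : Mat D} (hA : A.PosSemidef) :
    ((rtr A : ℂ) • (1 : Mat D) - A).PosSemidef := by
  set U : Mat D := (hA.1.eigenvectorUnitary : Mat D) with hU
  have hUU : U * star U = 1 := Unitary.coe_mul_star_self hA.1.eigenvectorUnitary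
  have hspec : A = U * diagonal (fun i => (hA.1.eigenvalues i : ℂ)) * star U := by
    have := hA.1.spectral_theorem
    rw [Unitary.conjStarAlgAut_apply] at this
    exact this
  have hsum : rtr A = ∑ i, hA.1.eigenvalues i := by
    rw [rtr, hA.1.trace_eq_sum_eigenvalues]
    simp
  have hdiag : (diagonal (fun i => ((rtr A - hA.1.eigenvalues i : ℝ) : ℂ)) : Mat D).PosSemidef := by
    refine PosSemidef.diagonal fun i => ?_
    have : hA.1.eigenvalues i ≤ rtr A := by
      rw [hsum]
      exact Finset.single_le_sum (fun j _ => hA.eigenvalues_nonneg j) (Finset.mem_univ i)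
    simpa using this
  have key : (rtr A : ℂ) • (1 : Mat D) - A =
      U * diagonal (fun i => ((rtr A - hA.1.eigenvalues i : ℝ) : ℂ)) * star U := by
    have : (diagonal (fun i => ((rtr A - hA.1.eigenvalues i : ℝ) : ℂ)) : Mat D) =
        (rtr A : ℂ) • (1 : Mat D) - diagonal (fun i => (hA.1.eigenvalues i : ℂ)) := by
      rw [← diagonal_one, ← diagonal_smul, diagonal_sub]
      congr 1
      ext i
      simp
    rw [this, Matrix.mul_sub, Matrix.sub_mul, ← hspec, mul_smul_comm, smul_mul_assoc, mul_one, hUU]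
  rw [key]
  exact hdiag.mul_mul_conjTranspose_same U

theorem rip_le {A X : Mat D} (hA : A.PosSemidef) (hX : X.PosSemidef) :
    rip A X ≤ rtr A * rtr X := by
  have := rip_nonneg (posSemidef_rtr_smul_one_sub hA) hX
  rw [rip_sub_left, rip_smul_left, rip_one_left] at this
  linarith

theorem rip_self (A : Mat D) : rip A A = ∑ i, ∑ j, ‖A i j‖ ^ 2 := by
  rw [rip, hsInner, Matrix.trace, Finset.sum_comm]
  simp [Matrix.mul_apply, ← Complex.normSq_eq_norm_sq, Complex.normSq_apply]

theorem norm_sq_entry_le (A : Mat D) (i j : Fin D) : ‖A i j‖ ^ 2 ≤ rip A A := by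
  rw [rip_self]
  exact (Finset.single_le_sum (f := fun j => ‖A i j‖ ^ 2) (fun _ _ => by positivity)
    (Finset.mem_univ j)).trans (Finset.single_le_sum (f := fun i => ∑ j, ‖A i j‖ ^ 2)
      (fun _ _ => by positivity) (Finset.mem_univ i))

theorem norm_entry_le_rtr {A : Mat D} (hA : A.PosSemidef) (i j : Fin D) : ‖A i j‖ ≤ rtr A := by
  refine le_of_sq_le_sq ?_ (rtr_nonneg hA)
  exact (norm_sq_entry_le A i j).trans ((rip_le hA hA).trans_eq (sq _).symm)

theorem posSemidef_sqrt (A : Mat D) : (CFC.sqrt (Aᴴ * A)).PosSemidef :=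
  (CFC.sqrt_nonneg _).posSemidef

theorem rip_sqrt (A : Mat D) : rip (CFC.sqrt (Aᴴ * A)) (CFC.sqrt (Aᴴ * A)) = rip A A := by
  rw [rip, hsInner, (posSemidef_sqrt A).1.eq,
    CFC.sqrt_mul_sqrt_self _ (posSemidef_conjTranspose_mul_self A).nonneg]
  rfl

theorem traceNorm_nonneg (A : Mat D) : 0 ≤ traceNorm A := rtr_nonneg (posSemidef_sqrt A)

theorem traceNorm_eq_rtr {A : Mat D} (hA : A.PosSemidef) : traceNorm A = rtr A := by
  rw [traceNorm, hA.1.eq, CFC.sqrt_mul_self _ hA.nonneg, rtr]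

theorem norm_entry_le_traceNorm (A : Mat D) (i j : Fin D) : ‖A i j‖ ≤ traceNorm A := by
  refine le_of_sq_le_sq ?_ (traceNorm_nonneg A)
  refine (norm_sq_entry_le A i j).trans ?_
  rw [← rip_sqrt, sq]
  exact rip_le (posSemidef_sqrt A) (posSemidef_sqrt A)

/-- The trace norm is at most `√D` times the Hilbert-Schmidt norm. -/
theorem traceNorm_sq_le (A : Mat D) : traceNorm A ^ 2 ≤ D * rip A A := by
  rcases Nat.eq_zero_or_pos D with rfl | hD
  · simp [traceNorm, Matrix.trace]
  have hD' : (0 : ℝ) < D := by exact_mod_cast hD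
  set B := CFC.sqrt (Aᴴ * A) with hB
  set c : ℝ := rtr B / D with hc
  have hnn : 0 ≤ rip (B - (c : ℂ) • 1) (B - (c : ℂ) • 1) := by
    rw [rip_self]
    positivity
  have h1 : rip (B - (c : ℂ) • 1) (B - (c : ℂ) • 1) = rip A A - (rtr B) ^ 2 / D := by
    rw [rip_sub_left, rip_smul_left, rip_one_left, rip_comm B, rip_sub_left, rip_smul_left,
      rip_one_left, rip_sqrt, rtr_sub, rtr_smul, rtr_one, hc]
    field_simp
    ring
  rw [h1, sub_nonneg, div_le_iff₀ hD'] at hnn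
  rw [mul_comm]
  exact hnn

theorem traceNorm_le_of_entry_le {A : Mat D} {c : ℝ} (hc : 0 ≤ c) (h : ∀ i j, ‖A i j‖ ≤ c) :
    traceNorm A ≤ D ^ 2 * c := by
  rcases Nat.eq_zero_or_pos D with rfl | hD
  · simp [traceNorm, Matrix.trace]
  have hD' : (1 : ℝ) ≤ D := by exact_mod_cast hD
  refine le_of_sq_le_sq ((traceNorm_sq_le A).trans ?_) (by positivity)
  have : rip A A ≤ D * (D * c ^ 2) := by
    rw [rip_self]
    calc ∑ i, ∑ j, ‖A i j‖ ^ 2 ≤ ∑ _i : Fin D, ∑ _j : Fin D, c ^ 2 := by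
          gcongr with i _ j _
          exact h i j
      _ = D * (D * c ^ 2) := by simp
  calc (D : ℝ) * rip A A ≤ D * (D * (D * c ^ 2)) := by gcongr
    _ = D ^ 3 * c ^ 2 := by ring
    _ ≤ D ^ 4 * c ^ 2 := by gcongr; norm_num
    _ = (D ^ 2 * c) ^ 2 := by ring

/-! ### Density matrices -/

theorem rtr_of_mem {X : Mat D} (hX : X ∈ densities D) : rtr X = 1 := by simp [rtr, hX.2]

theorem mem_densities_iff {X : Mat D} : X ∈ densities D ↔ X.PosSemidef ∧ rtr X = 1 :=
  ⟨fun h => ⟨h.1, rtr_of_mem h⟩, fun h => ⟨h.1, by rw [trace_eq_rtr h.1, h.2, Complex.ofReal_one]⟩⟩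

/-- The scaling of a matrix to trace one. -/
noncomputable def normalize (A : Mat D) : Mat D := (((rtr A)⁻¹ : ℝ) : ℂ) • A

theorem normalize_mem {A : Mat D} (hA : A.PosSemidef) (h : 0 < rtr A) :
    normalize A ∈ densities D :=
  mem_densities_iff.2 ⟨posSemidef_smul hA (inv_nonneg.2 h.le), by
    rw [normalize, rtr_smul, inv_mul_cancel₀ h.ne']⟩

theorem rtr_smul_normalize {A : Mat D} (h : 0 < rtr A) : (rtr A : ℂ) • normalize A = A := by
  rw [normalize, smul_smul, ← Complex.ofReal_mul, mul_inv_cancel₀ h.ne', Complex.ofReal_one,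
    one_smul]

theorem normalize_smul {r : ℝ} (hr : 0 < r) (A : Mat D) :
    normalize ((r : ℂ) • A) = normalize A := by
  rw [normalize, normalize, rtr_smul, smul_smul, ← Complex.ofReal_mul]
  congr 2
  field_simp

theorem normalize_of_mem {X : Mat D} (hX : X ∈ densities D) : normalize X = X := by
  simp [normalize, rtr_of_mem hX]

theorem normalize_one_mem (hD : 1 ≤ D) : normalize (1 : Mat D) ∈ densities D :=
  normalize_mem PosSemidef.one (by rw [rtr_one]; exact_mod_cast hD)

theorem isClosed_posSemidef : IsClosed {A : Mat D | A.PosSemidef} := by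
  have : {A : Mat D | A.PosSemidef} =
      {A : Mat D | Aᴴ = A} ∩ ⋂ x : Fin D → ℂ, {A : Mat D | 0 ≤ star x ⬝ᵥ (A *ᵥ x)} := by
    ext A
    simp [posSemidef_iff_dotProduct_mulVec, IsHermitian]
  rw [this]
  refine (isClosed_eq (by fun_prop) (by fun_prop)).inter (isClosed_iInter fun x => ?_)
  exact isClosed_le continuous_const (by fun_prop)

theorem isClosed_densities : IsClosed (densities D) :=
  isClosed_posSemidef.inter (isClosed_eq (by fun_prop) (by fun_prop))

theorem isCompact_densities : IsCompact (densities D) := by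
  have h : IsCompact (Set.univ.pi fun _ : Fin D => Set.univ.pi fun _ : Fin D =>
      Metric.closedBall (0 : ℂ) 1) :=
    isCompact_univ_pi fun _ => isCompact_univ_pi fun _ => isCompact_closedBall _ _
  refine IsCompact.of_isClosed_subset h isClosed_densities fun X hX i _ j _ => ?_
  rw [mem_closedBall_zero_iff, ← rtr_of_mem hX]
  exact norm_entry_le_rtr hX.1 i j

/-- The cone of positive semi-definite matrices is self-dual. -/
theorem posSemidef_of_rip_nonneg {A : Mat D} (hA : A.IsHermitian)
    (h : ∀ X ∈ densities D, 0 ≤ rip A X) : A.PosSemidef := by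
  refine PosSemidef.of_dotProduct_mulVec_nonneg hA fun x => ?_
  have hX := posSemidef_vecMulVec_self_star x
  have heq : hsInner A (vecMulVec x (star x)) = star x ⬝ᵥ (A *ᵥ x) := by
    rw [hsInner, hA.eq, mul_vecMulVec, trace_vecMulVec, dotProduct_comm]
  have hre : 0 ≤ rip A (vecMulVec x (star x)) := by
    by_cases h0 : vecMulVec x (star x) = 0
    · simp [h0, rip, hsInner]
    · have hpos := rtr_pos_of_ne_zero hX h0
      rw [← rtr_smul_normalize hpos, rip_smul_right]
      exact mul_nonneg hpos.le (h _ (normalize_mem hX hpos))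
  have him : (star x ⬝ᵥ (A *ᵥ x)).im = 0 := hA.im_star_dotProduct_mulVec_self x
  rw [rip, heq] at hre
  exact Complex.le_def.2 ⟨hre, him.symm⟩

theorem posDef_of_sub_smul_one {A : Mat D} {c : ℝ} (hc : 0 < c)
    (h : (A - (c : ℂ) • (1 : Mat D)).PosSemidef) : A.PosDef := by
  have := (PosDef.one (n := Fin D) (R := ℂ)).smul (show (0 : ℂ) < c by exact_mod_cast hc)
  simpa using this.add_posSemidef h

theorem rip_pos {A X : Mat D} (hA : A.PosDef) (hX : X ∈ densities D) : 0 < rip A X := by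
  obtain ⟨B, hB⟩ := CStarAlgebra.nonneg_iff_eq_star_mul_self.1 hA.posSemidef.nonneg
  have hBu : IsUnit B := by
    have := hA.isUnit
    rw [hB] at this
    exact isUnit_of_mul_isUnit_right this
  have h1 : hsInner A X = (B * X * Bᴴ).trace := by
    rw [hsInner, hA.1.eq, hB, star_eq_conjTranspose, Matrix.mul_assoc, Matrix.trace_mul_comm,
      Matrix.mul_assoc]
  rw [rip, h1]
  refine rtr_pos_of_ne_zero (hX.1.mul_mul_conjTranspose_same B) fun h0 => ?_
  have h2 : X = 0 := by
    rwa [← star_eq_conjTranspose, hBu.star.mul_left_eq_zero, hBu.mul_right_eq_zero] at h0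
  have := rtr_of_mem hX
  simp [h2] at this

/-! ### Positive maps -/

theorem IsPositiveMap.comp {φ ψ : SuperOp D} (hφ : IsPositiveMap φ) (hψ : IsPositiveMap ψ) :
    IsPositiveMap (φ ∘ₗ ψ) := fun X hX => hφ _ (hψ X hX)

theorem adj_comp (φ ψ : SuperOp D) : adj (φ ∘ₗ ψ) = adj ψ ∘ₗ adj φ :=
  (eq_adj _ _ fun A B => by
    rw [LinearMap.comp_apply, hsInner_adj, hsInner_adj, LinearMap.comp_apply]).symm

theorem adj_id : adj (LinearMap.id : SuperOp D) = LinearMap.id :=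
  (eq_adj LinearMap.id LinearMap.id fun _ _ => rfl).symm

section Span

open scoped Matrix.Norms.L2Operator

theorem span_posSemidef : Submodule.span ℂ {A : Mat D | A.PosSemidef} = ⊤ := by
  have h : {A : Mat D | A.PosSemidef} = {A : Mat D | 0 ≤ A} :=
    Set.ext fun A => (Matrix.nonneg_iff_posSemidef (A := A)).symm
  rw [h]
  exact CStarAlgebra.span_nonneg (A := Mat D)

end Span

/-- A positive map commutes with the conjugate transpose, since it does so on the positive
matrices, which span. -/
theorem IsPositiveMap.map_conjTranspose {φ : SuperOp D} (hφ : IsPositiveMap φ) (A : Mat D) :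
    φ Aᴴ = (φ A)ᴴ := by
  have hA : A ∈ Submodule.span ℂ {A : Mat D | A.PosSemidef} := span_posSemidef ▸ trivial
  induction hA using Submodule.span_induction with
  | mem A hA => rw [hA.1.eq, (hφ A hA).1.eq]
  | zero => simp
  | add A B _ _ hA hB => simp [conjTranspose_add, hA, hB]
  | smul c A _ hA => simp [conjTranspose_smul, hA]

theorem IsPositiveMap.adj {φ : SuperOp D} (hφ : IsPositiveMap φ) : IsPositiveMap (adj φ) := by
  intro A hA
  refine posSemidef_of_rip_nonneg ?_ fun X hX => ?_
  · ext i j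
    have h := hφ.map_conjTranspose (Matrix.single j i 1)
    rw [conjTranspose_single, star_one] at h
    rw [conjTranspose_apply]
    change star (star (hsInner A _)) = star (hsInner A _)
    rw [h, star_star, hsInner, hsInner, hA.1.eq, ← trace_conjTranspose, conjTranspose_mul,
      conjTranspose_conjTranspose, hA.1.eq, trace_mul_comm]
  · rw [← rip_adj]
    exact rip_nonneg hA (hφ X hX.1)

/-- A positive map is monotone for the trace: this is `X ≤ Tr X` under `φ` and the trace. -/
theorem IsPositiveMap.rtr_le {φ : SuperOp D} (hφ : IsPositiveMap φ) {X : Mat D}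
    (hX : X.PosSemidef) : rtr (φ X) ≤ rtr X * rtr (φ 1) := by
  have := rtr_nonneg (hφ _ (posSemidef_rtr_smul_one_sub hX))
  rw [map_sub, map_smul, rtr_sub, rtr_smul] at this
  linarith

/-- The entries of `φ A`, for positive `φ`, are controlled by the trace of `φ 1`. -/
theorem exists_norm_entry_le (A : Mat D) : ∃ C : ℝ, 0 ≤ C ∧ ∀ φ : SuperOp D, IsPositiveMap φ →
    ∀ i j, ‖φ A i j‖ ≤ C * rtr (φ 1) := by
  have hA : A ∈ Submodule.span ℂ {A : Mat D | A.PosSemidef} := span_posSemidef ▸ trivial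
  induction hA using Submodule.span_induction with
  | mem A hA =>
    exact ⟨rtr A, rtr_nonneg hA, fun φ hφ i j =>
      (norm_entry_le_rtr (hφ A hA) i j).trans (hφ.rtr_le hA)⟩
  | zero => exact ⟨0, le_rfl, fun φ _ i j => by simp⟩
  | add A B _ _ hA hB =>
    obtain ⟨C, hC, h1⟩ := hA
    obtain ⟨C', hC', h2⟩ := hB
    refine ⟨C + C', add_nonneg hC hC', fun φ hφ i j => ?_⟩
    rw [map_add, add_mul]
    exact (norm_add_le _ _).trans (add_le_add (h1 φ hφ i j) (h2 φ hφ i j))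
  | smul c A _ hA =>
    obtain ⟨C, hC, h1⟩ := hA
    refine ⟨‖c‖ * C, by positivity, fun φ hφ i j => ?_⟩
    rw [map_smul, Matrix.smul_apply, norm_smul, mul_assoc]
    exact mul_le_mul_of_nonneg_left (h1 φ hφ i j) (norm_nonneg c)

theorem exists_traceNorm_le : ∃ C : ℝ, 0 ≤ C ∧ ∀ φ : SuperOp D, IsPositiveMap φ →
    ∀ A, traceNorm (φ A) ≤ C * traceNorm A * rtr (φ 1) := by
  choose C hC h using fun p : Fin D × Fin D =>
    exists_norm_entry_le (Matrix.single p.1 p.2 1 : Mat D)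
  refine ⟨D ^ 2 * ∑ p, C p, mul_nonneg (by positivity) (Finset.sum_nonneg fun p _ => hC p),
    fun φ hφ A => ?_⟩
  have h1 : 0 ≤ rtr (φ 1) := rtr_nonneg (hφ _ PosSemidef.one)
  have hsum : 0 ≤ ∑ p, C p := Finset.sum_nonneg fun p _ => hC p
  have hT := traceNorm_nonneg A
  have := traceNorm_le_of_entry_le (A := φ A) (c := (∑ p, C p) * traceNorm A * rtr (φ 1))
    (by positivity) fun i j => ?_
  · exact this.trans_eq (by ring)
  have hdec : φ A i j = ∑ p : Fin D × Fin D, A p.1 p.2 * φ (Matrix.single p.1 p.2 1) i j := by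
    conv_lhs => rw [matrix_eq_sum_single A]
    rw [Fintype.sum_prod_type]
    simp only [map_sum, Matrix.sum_apply]
    refine Finset.sum_congr rfl fun k _ => Finset.sum_congr rfl fun l _ => ?_
    rw [← mul_one (A k l), ← smul_eq_mul, ← Matrix.smul_single, map_smul]
    simp
  rw [hdec, Finset.sum_mul, Finset.sum_mul]
  refine norm_sum_le_of_le _ fun p _ => ?_
  rw [norm_mul, mul_comm (C p), mul_assoc]
  exact mul_le_mul (norm_entry_le_traceNorm A _ _) (h p φ hφ i j) (norm_nonneg _) hT

/-- The operator norm of a positive map is comparable to the trace of its value at `1`. -/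
theorem exists_opNorm_le : ∃ C : ℝ, 0 ≤ C ∧ ∀ φ : SuperOp D, IsPositiveMap φ →
    opNorm φ ≤ C * rtr (φ 1) ∧ ∀ X ∈ densities D, rtr (φ X) ≤ opNorm φ := by
  obtain ⟨C, hC, h⟩ := exists_traceNorm_le (D := D)
  refine ⟨C, hC, fun φ hφ => ?_⟩
  have h1 : 0 ≤ rtr (φ 1) := rtr_nonneg (hφ _ PosSemidef.one)
  have hbd : ∀ r ∈ {r | ∃ A : Mat D, traceNorm A = 1 ∧ r = traceNorm (φ A)},
      r ≤ C * rtr (φ 1) := by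
    rintro _ ⟨A, hA, rfl⟩
    simpa [hA] using h φ hφ A
  refine ⟨Real.sSup_le hbd (by positivity), fun X hX => ?_⟩
  refine le_csSup ⟨_, hbd⟩ ⟨X, ?_, ?_⟩
  · rw [traceNorm_eq_rtr hX.1, rtr_of_mem hX]
  · rw [traceNorm_eq_rtr (hφ X hX.1)]

theorem v_le {φ : SuperOp D} (hφ : IsPositiveMap φ) {X : Mat D} (hX : X ∈ densities D) :
    v φ ≤ rtr (φ X) := by
  refine csInf_le ⟨0, ?_⟩ ⟨X, hX, (traceNorm_eq_rtr (hφ X hX.1)).symm⟩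
  rintro _ ⟨X, -, rfl⟩
  exact traceNorm_nonneg _

end Matrices

/-! ### Projective contraction -/

section Contraction

open Matrix

variable {D : ℕ}

/-- A positive map that does not annihilate any density matrix, so that its projective action
`X ↦ normalize (φ X)` on the density matrices is defined. -/
structure IsNondegenerate (φ : SuperOp D) : Prop where
  pos : IsPositiveMap φ
  rtr_pos : ∀ X ∈ densities D, 0 < rtr (φ X)

/-- `φ` maps every density matrix to a matrix that dominates the multiple `δ` of its own trace.
The inequality `φ Y ≥ δ Tr (φ Y)` is tested against density matrices. -/
def Spreads (δ : ℝ) (φ : SuperOp D) : Prop :=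
  ∀ Y ∈ densities D, ∀ X ∈ densities D, δ * rtr (φ Y) ≤ rip (φ Y) X

theorem IsNondegenerate.id : IsNondegenerate (LinearMap.id : SuperOp D) :=
  ⟨fun _ h => h, fun X hX => by simp [rtr_of_mem hX]⟩

theorem IsNondegenerate.normalize_mem {φ : SuperOp D} (hφ : IsNondegenerate φ) {X : Mat D}
    (hX : X ∈ densities D) : normalize (φ X) ∈ densities D :=
  PosProd.normalize_mem (hφ.pos X hX.1) (hφ.rtr_pos X hX)

theorem IsNondegenerate.map_eq {φ : SuperOp D} (hφ : IsNondegenerate φ) {X : Mat D}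
    (hX : X ∈ densities D) : (rtr (φ X) : ℂ) • normalize (φ X) = φ X :=
  rtr_smul_normalize (hφ.rtr_pos X hX)

theorem IsNondegenerate.rtr_pos' {φ : SuperOp D} (hφ : IsNondegenerate φ) {A : Mat D}
    (hA : A.PosSemidef) (h : 0 < rtr A) : 0 < rtr (φ A) := by
  rw [← rtr_smul_normalize h, map_smul, rtr_smul]
  exact mul_pos h (hφ.rtr_pos _ (PosProd.normalize_mem hA h))

theorem IsNondegenerate.rtr_one_pos (hD : 1 ≤ D) {φ : SuperOp D} (hφ : IsNondegenerate φ) :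
    0 < rtr (φ 1) :=
  hφ.rtr_pos' PosSemidef.one (by rw [rtr_one]; exact_mod_cast hD)

theorem IsNondegenerate.comp {φ ψ : SuperOp D} (hφ : IsNondegenerate φ) (hψ : IsNondegenerate ψ) :
    IsNondegenerate (φ ∘ₗ ψ) :=
  ⟨hφ.pos.comp hψ.pos, fun X hX => hφ.rtr_pos' (hψ.pos X hX.1) (hψ.rtr_pos X hX)⟩

theorem normalize_comp {φ ψ : SuperOp D} (hψ : IsNondegenerate ψ) {X : Mat D}
    (hX : X ∈ densities D) : normalize ((φ ∘ₗ ψ) X) = normalize (φ (normalize (ψ X))) := by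
  conv_lhs => rw [LinearMap.comp_apply, ← hψ.map_eq hX, map_smul,
    normalize_smul (hψ.rtr_pos X hX)]

theorem Spreads.mono {δ δ' : ℝ} {φ : SuperOp D} (h : Spreads δ φ) (hφ : IsPositiveMap φ)
    (hδ : δ' ≤ δ) : Spreads δ' φ := fun Y hY X hX =>
  (mul_le_mul_of_nonneg_right hδ (rtr_nonneg (hφ Y hY.1))).trans (h Y hY X hX)

theorem Spreads.comp {δ : ℝ} {φ ψ : SuperOp D} (h : Spreads δ φ) (hψ : IsNondegenerate ψ) :
    Spreads δ (φ ∘ₗ ψ) := by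
  intro Y hY X hX
  rw [LinearMap.comp_apply, ← hψ.map_eq hY, map_smul, rtr_smul, rip_smul_left, mul_left_comm]
  exact mul_le_mul_of_nonneg_left (h _ (hψ.normalize_mem hY) X hX) (hψ.rtr_pos Y hY).le

theorem Spreads.sub_posSemidef {δ : ℝ} {φ : SuperOp D} (h : Spreads δ φ) (hφ : IsNondegenerate φ)
    {Y : Mat D} (hY : Y ∈ densities D) :
    (normalize (φ Y) - (δ : ℂ) • (1 : Mat D)).PosSemidef := by
  have hpos := hφ.rtr_pos Y hY
  refine posSemidef_of_rip_nonneg ?_ fun X hX => ?_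
  · exact (hφ.normalize_mem hY).1.1.sub (by simp [IsHermitian, conjTranspose_smul])
  · rw [rip_sub_left, rip_smul_left, rip_one_left, rtr_of_mem hX, normalize, rip_smul_left,
      sub_nonneg, mul_one, le_inv_mul_iff₀ hpos, mul_comm]
    exact h Y hY X hX

/-- Strict positivity of a map gives, by compactness of the density matrices, a quantitative
lower bound for its adjoint. -/
theorem IsStrictlyPositive.adj_spreads (hD : 1 ≤ D) {φ : SuperOp D} (hφ : IsPositiveMap φ)
    (h : IsStrictlyPositive φ) : IsNondegenerate (adj φ) ∧ ∃ δ > 0, Spreads δ (adj φ) := by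
  have hpos : ∀ Y ∈ densities D, ∀ X ∈ densities D, 0 < rip (adj φ Y) X := by
    intro Y hY X hX
    rw [← rip_adj, rip_comm]
    exact rip_pos (h X hX) hY
  have hnd : IsNondegenerate (adj φ) := by
    refine ⟨hφ.adj, fun Y hY => ?_⟩
    have h1 := hpos Y hY _ (normalize_one_mem hD)
    rw [normalize, rip_smul_right, rip_one_right] at h1
    rw [rtr_one] at h1
    exact (mul_pos_iff_of_pos_left (inv_pos.2 (by exact_mod_cast hD))).1 h1
  refine ⟨hnd, ?_⟩
  obtain ⟨p, hp, hmin⟩ := (isCompact_densities.prod (isCompact_densities (D := D))).exists_isMinOn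
    ⟨(normalize 1, normalize 1), normalize_one_mem hD, normalize_one_mem hD⟩
    (continuous_rip_superOp (adj φ)).continuousOn
  have hb := hnd.rtr_one_pos hD
  refine ⟨rip (adj φ p.1) p.2 / rtr (adj φ 1), div_pos (hpos _ hp.1 _ hp.2) hb,
    fun Y hY X hX => ?_⟩
  have h1 : rtr (adj φ Y) ≤ rtr (adj φ 1) := by
    simpa [rtr_of_mem hY] using hnd.pos.rtr_le hY.1
  rw [div_mul_eq_mul_div, div_le_iff₀ hb]
  exact mul_le_mul (isMinOn_iff.1 hmin (Y, X) ⟨hY, hX⟩) h1 (hnd.rtr_pos Y hY).le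
    (hpos Y hY X hX).le

/-- If `V ≥ δ`, the projective image of `V` is a convex combination, with weights `δ` and `1 - δ`,
of the image of the identity and another point of the image. -/
theorem exists_normalize_eq_add (hD : 1 ≤ D) {φ : SuperOp D} (hφ : IsNondegenerate φ) {δ : ℝ}
    (hδ0 : 0 ≤ δ) (hδ1 : δ < 1) {V : Mat D} (hV : V ∈ densities D)
    (hVδ : (V - (δ : ℂ) • (1 : Mat D)).PosSemidef) :
    ∃ V' ∈ densities D, normalize (φ V) =
      (δ : ℂ) • normalize (φ 1) + ((1 - δ : ℝ) : ℂ) • normalize (φ V') := by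
  have h1 := hφ.rtr_one_pos hD
  have hVp := hφ.rtr_pos V hV
  set s := rtr (φ V) / rtr (φ 1) with hs
  have hs1 : s ≤ 1 := (div_le_one h1).2 (by simpa [rtr_of_mem hV] using hφ.pos.rtr_le hV.1)
  set W : Mat D := V - ((δ * s : ℝ) : ℂ) • (1 : Mat D) with hW
  have hWp : W.PosSemidef := by
    have : W = (V - (δ : ℂ) • (1 : Mat D)) + ((δ * (1 - s) : ℝ) : ℂ) • (1 : Mat D) := by
      rw [hW]
      push_cast
      module
    rw [this]
    exact hVδ.add (posSemidef_smul PosSemidef.one (mul_nonneg hδ0 (by linarith)))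
  have hφW : φ W = φ V - ((δ * s : ℝ) : ℂ) • φ 1 := by rw [hW, map_sub, map_smul]
  have hrW : rtr (φ W) = (1 - δ) * rtr (φ V) := by
    rw [hφW, rtr_sub, rtr_smul, hs]
    field_simp
  have hδ' : 0 < 1 - δ := by linarith
  have hrWp : 0 < rtr (φ W) := by rw [hrW]; positivity
  have hWtr : 0 < rtr W := by
    refine rtr_pos_of_ne_zero hWp fun h0 => ?_
    simp [h0] at hrWp
  refine ⟨normalize W, normalize_mem hWp hWtr, ?_⟩
  have h2 : normalize (φ (normalize W)) = normalize (φ W) := by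
    conv_rhs => rw [← rtr_smul_normalize hWtr, map_smul, normalize_smul hWtr]
  rw [h2, normalize, normalize, normalize, hrW, hφW, smul_sub, smul_sub, smul_smul, smul_smul,
    smul_smul, smul_smul]
  have e1 : (((1 - δ : ℝ) : ℂ) * ((((1 - δ) * rtr (φ V))⁻¹ : ℝ) : ℂ)) =
      (((rtr (φ V))⁻¹ : ℝ) : ℂ) := by
    rw [← Complex.ofReal_mul]
    congr 1
    field_simp
  have e2 : (((rtr (φ V))⁻¹ : ℝ) : ℂ) * ((δ * s : ℝ) : ℂ) =
      (δ : ℂ) * (((rtr (φ 1))⁻¹ : ℝ) : ℂ) := by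
    simp only [← Complex.ofReal_mul]
    congr 1
    rw [hs]
    field_simp
  rw [e1, e2]
  abel

/-- The projective image of the density matrices under `φ` has entrywise diameter at most `d`. -/
def OscLe (φ : SuperOp D) (d : ℝ) : Prop :=
  ∀ U ∈ densities D, ∀ V ∈ densities D, ∀ i j,
    ‖normalize (φ U) i j - normalize (φ V) i j‖ ≤ d

theorem OscLe.comp {φ ψ : SuperOp D} {d : ℝ} (h : OscLe φ d) (hψ : IsNondegenerate ψ) :
    OscLe (φ ∘ₗ ψ) d := by
  intro U hU V hV i j
  rw [normalize_comp hψ hU, normalize_comp hψ hV]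
  exact h _ (hψ.normalize_mem hU) _ (hψ.normalize_mem hV) i j

/-- A spreading map in the product contracts the projective diameter by the factor `1 - δ`. -/
theorem OscLe.comp_spreads (hD : 1 ≤ D) {φ ψ : SuperOp D} {d δ : ℝ} (h : OscLe φ d)
    (hφ : IsNondegenerate φ) (hψ : IsNondegenerate ψ) (hδ0 : 0 ≤ δ) (hδ1 : δ < 1)
    (hs : Spreads δ ψ) : OscLe (φ ∘ₗ ψ) ((1 - δ) * d) := by
  intro U hU V hV i j
  rw [normalize_comp hψ hU, normalize_comp hψ hV]
  obtain ⟨U', hU', h1⟩ := exists_normalize_eq_add hD hφ hδ0 hδ1 (hψ.normalize_mem hU)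
    (hs.sub_posSemidef hψ hU)
  obtain ⟨V', hV', h2⟩ := exists_normalize_eq_add hD hφ hδ0 hδ1 (hψ.normalize_mem hV)
    (hs.sub_posSemidef hψ hV)
  have hδ' : 0 ≤ 1 - δ := by linarith
  rw [h1, h2]
  simp only [Matrix.add_apply, Matrix.smul_apply, add_sub_add_left_eq_sub, smul_eq_mul, ← mul_sub]
  rw [norm_mul, Complex.norm_real, Real.norm_of_nonneg hδ']
  exact mul_le_mul_of_nonneg_left (h U' hU' V' hV' i j) hδ'

theorem oscLe_two {φ : SuperOp D} (hφ : IsNondegenerate φ) : OscLe φ 2 := by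
  intro U hU V hV i j
  have h1 := norm_entry_le_rtr (hφ.normalize_mem hU).1 i j
  have h2 := norm_entry_le_rtr (hφ.normalize_mem hV).1 i j
  rw [rtr_of_mem (hφ.normalize_mem hU)] at h1
  rw [rtr_of_mem (hφ.normalize_mem hV)] at h2
  exact (norm_sub_le _ _).trans (by linarith)

/-- The product `ψ₀ ∘ ⋯ ∘ ψₙ₋₁`. -/
noncomputable def fwd (ψ : ℕ → SuperOp D) : ℕ → SuperOp D
  | 0 => LinearMap.id
  | n + 1 => fwd ψ n ∘ₗ ψ n

theorem fwd_add (ψ : ℕ → SuperOp D) (m k : ℕ) :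
    fwd ψ (m + k) = fwd ψ m ∘ₗ fwd (fun j => ψ (m + j)) k := by
  induction k with
  | zero => rfl
  | succ k ih => rw [← add_assoc, fwd, ih, fwd, LinearMap.comp_assoc]

theorem fwd_one_add (ψ : ℕ → SuperOp D) (n : ℕ) :
    fwd ψ (n + 1) = ψ 0 ∘ₗ fwd (fun j => ψ (j + 1)) n := by
  rw [add_comm n 1, fwd_add]
  simp [fwd, add_comm 1]

theorem isNondegenerate_fwd {ψ : ℕ → SuperOp D} (hψ : ∀ k, IsNondegenerate (ψ k)) (n : ℕ) :
    IsNondegenerate (fwd ψ n) := by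
  induction n with
  | zero => exact .id
  | succ n ih => exact ih.comp (hψ n)

/-- `Z` is the common projective limit of the products `ψ₀ ∘ ⋯ ∘ ψₙ₋₁`, whatever the density
matrices they are applied to. -/
def IsLimitState (ψ : ℕ → SuperOp D) (Z : Mat D) : Prop :=
  Z ∈ densities D ∧ ∀ Y : ℕ → Mat D, (∀ᶠ n in atTop, Y n ∈ densities D) →
    Tendsto (fun n => normalize (fwd ψ n (Y n))) atTop (𝓝 Z)

theorem exists_oscLe_fwd (hD : 1 ≤ D) {ψ : ℕ → SuperOp D} (hψ : ∀ k, IsNondegenerate (ψ k))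
    {K : ℕ} {δ : ℝ} (hδ0 : 0 < δ) (hδ1 : δ < 1)
    (hf : ∃ᶠ m in atTop, Spreads δ (fwd (fun j => ψ (m + j)) K)) {ε : ℝ} (hε : 0 < ε) :
    ∃ N, ∀ n ≥ N, OscLe (fwd ψ n) ε := by
  have hmono : ∀ {N n : ℕ} {d : ℝ}, OscLe (fwd ψ N) d → N ≤ n → OscLe (fwd ψ n) d := by
    intro N n d h hn
    obtain ⟨k, rfl⟩ := Nat.exists_eq_add_of_le hn
    rw [fwd_add]
    exact h.comp (isNondegenerate_fwd (fun j => hψ _) k)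
  have key : ∀ r : ℕ, ∃ N, OscLe (fwd ψ N) (2 * (1 - δ) ^ r) := by
    intro r
    induction r with
    | zero => exact ⟨0, by simpa using oscLe_two (isNondegenerate_fwd hψ 0)⟩
    | succ r ih =>
      obtain ⟨N, hN⟩ := ih
      obtain ⟨m, hm, hs⟩ := (frequently_atTop.1 hf) N
      refine ⟨m + K, ?_⟩
      rw [fwd_add, pow_succ', mul_left_comm]
      exact (hmono hN hm).comp_spreads hD (isNondegenerate_fwd hψ m)
        (isNondegenerate_fwd (fun j => hψ _) K) hδ0.le hδ1 hs
  obtain ⟨r, hr⟩ := exists_pow_lt_of_lt_one (half_pos hε) (show 1 - δ < 1 by linarith)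
  obtain ⟨N, hN⟩ := key r
  exact ⟨N, fun n hn U hU V hV i j =>
    (hmono hN hn U hU V hV i j).trans (by linarith)⟩

theorem exists_isLimitState (hD : 1 ≤ D) {ψ : ℕ → SuperOp D} (hψ : ∀ k, IsNondegenerate (ψ k))
    {K : ℕ} {δ : ℝ} (hδ0 : 0 < δ) (hδ1 : δ < 1)
    (hf : ∃ᶠ m in atTop, Spreads δ (fwd (fun j => ψ (m + j)) K)) :
    ∃ Z, IsLimitState ψ Z := by
  have hosc := fun (ε : ℝ) (hε : 0 < ε) => exists_oscLe_fwd hD hψ hδ0 hδ1 hf hε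
  set X₀ : Mat D := normalize 1
  have hX₀ : X₀ ∈ densities D := normalize_one_mem hD
  have hdens := fun n => (isNondegenerate_fwd hψ n).normalize_mem hX₀
  -- the images at times `n ≥ N` all lie in the projective image at time `N`
  have hcmp : ∀ ε > 0, ∃ N, ∀ n ≥ N, ∀ U ∈ densities D, ∀ i j,
      ‖normalize (fwd ψ n U) i j - normalize (fwd ψ N X₀) i j‖ ≤ ε := by
    intro ε hε
    obtain ⟨N, hN⟩ := hosc ε hε
    refine ⟨N, fun n hn U hU i j => ?_⟩
    obtain ⟨k, rfl⟩ := Nat.exists_eq_add_of_le hn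
    have hk := isNondegenerate_fwd (ψ := fun j => ψ (N + j)) (fun j => hψ _) k
    rw [fwd_add, normalize_comp hk hU]
    exact hN N le_rfl _ (hk.normalize_mem hU) _ hX₀ i j
  obtain ⟨Z, hZ, φ, hφ, hlim⟩ := isCompact_densities.tendsto_subseq hdens
  refine ⟨Z, hZ, fun Y hY => ?_⟩
  have hZε : ∀ ε > 0, ∀ᶠ n in atTop, ∀ U ∈ densities D, ∀ i j,
      ‖normalize (fwd ψ n U) i j - Z i j‖ ≤ ε := by
    intro ε hε
    obtain ⟨N, hN⟩ := hcmp (ε / 2) (half_pos hε)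
    have hZN : ∀ i j, ‖Z i j - normalize (fwd ψ N X₀) i j‖ ≤ ε / 2 := by
      intro i j
      have hij : Tendsto (fun n => normalize (fwd ψ (φ n) X₀) i j) atTop (𝓝 (Z i j)) :=
        ((continuous_id.matrix_elem i j).tendsto Z).comp hlim
      refine le_of_tendsto (hij.sub_const _).norm ?_
      filter_upwards [hφ.tendsto_atTop.eventually_ge_atTop N] with n hn
      exact hN _ hn _ hX₀ i j
    filter_upwards [eventually_ge_atTop N] with n hn U hU i j
    have h1 := hN n hn U hU i j
    have h2 := hZN i j
    rw [norm_sub_rev] at h2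
    refine (norm_sub_le_norm_sub_add_norm_sub _ (normalize (fwd ψ N X₀) i j) _).trans ?_
    linarith
  refine tendsto_pi_nhds.2 fun i => tendsto_pi_nhds.2 fun j => ?_
  refine Metric.tendsto_nhds.2 fun ε hε => ?_
  filter_upwards [hZε (ε / 2) (half_pos hε), hY] with n hn hYn
  rw [dist_eq_norm]
  exact (hn _ hYn i j).trans_lt (by linarith)

theorem continuousAt_normalize {A : Mat D} (h : rtr A ≠ 0) : ContinuousAt normalize A := by
  unfold normalize
  refine ContinuousAt.smul (f := fun A : Mat D => (((rtr A)⁻¹ : ℝ) : ℂ)) ?_ continuousAt_id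
  exact Complex.continuous_ofReal.continuousAt.comp (continuous_rtr.continuousAt.inv₀ h)

/-- Limit states are carried to each other by the cocycle. -/
theorem IsLimitState.cons (hD : 1 ≤ D) {ψ : ℕ → SuperOp D} (hψ : ∀ k, IsNondegenerate (ψ k))
    {Z Z' : Mat D} (h : IsLimitState ψ Z) (h' : IsLimitState (fun j => ψ (j + 1)) Z') :
    normalize (ψ 0 Z') = Z := by
  set X₀ : Mat D := normalize 1
  have hX₀ : X₀ ∈ densities D := normalize_one_mem hD
  have h1 := (tendsto_add_atTop_iff_nat 1).2 (h.2 (fun _ => X₀) (.of_forall fun _ => hX₀))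
  have h2 := h'.2 (fun _ => X₀) (.of_forall fun _ => hX₀)
  have h3 : ContinuousAt (fun A => normalize (ψ 0 A)) Z' :=
    ContinuousAt.comp (f := fun A => ψ 0 A)
      (continuousAt_normalize ((hψ 0).rtr_pos Z' h'.1).ne')
      (continuous_superOp (ψ 0)).continuousAt
  refine tendsto_nhds_unique (h3.tendsto.comp h2) (h1.congr fun n => ?_)
  rw [fwd_one_add, normalize_comp (isNondegenerate_fwd (fun j => hψ _) n) hX₀]
  rfl

/-- A limit state inherits the lower bound of every spreading initial product. -/
theorem IsLimitState.sub_posSemidef (hD : 1 ≤ D) {ψ : ℕ → SuperOp D}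
    (hψ : ∀ k, IsNondegenerate (ψ k)) {Z : Mat D} (h : IsLimitState ψ Z) {N : ℕ} {δ : ℝ}
    (hs : Spreads δ (fwd ψ N)) : (Z - (δ : ℂ) • (1 : Mat D)).PosSemidef := by
  have h1 := (h.2 (fun _ => normalize 1) (.of_forall fun _ => normalize_one_mem hD)).sub_const
    ((δ : ℂ) • (1 : Mat D))
  refine isClosed_posSemidef.mem_of_tendsto h1 ?_
  filter_upwards [eventually_ge_atTop N] with n hn
  obtain ⟨k, rfl⟩ := Nat.exists_eq_add_of_le hn
  rw [fwd_add]
  have hk := isNondegenerate_fwd (ψ := fun j => ψ (N + j)) (fun j => hψ _) k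
  exact (hs.comp hk).sub_posSemidef ((isNondegenerate_fwd hψ N).comp hk) (normalize_one_mem hD)

end Contraction

/-! ### Perron-Frobenius theory of a strictly positive map -/

section PerronFrobenius

open Matrix

variable {D : ℕ}

theorem IsPositiveMap.pow {φ : SuperOp D} (hφ : IsPositiveMap φ) (n : ℕ) :
    IsPositiveMap (φ ^ n) := by
  induction n with
  | zero => exact fun _ h => h
  | succ n ih =>
    rw [pow_succ']
    exact IsPositiveMap.comp hφ ih

theorem mul_rtr_le_rip {Z X : Mat D} {c : ℝ} (hZ : (Z - (c : ℂ) • (1 : Mat D)).PosSemidef)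
    (hX : X.PosSemidef) : c * rtr X ≤ rip Z X := by
  have := rip_nonneg hZ hX
  rw [rip_sub_left, rip_smul_left, rip_one_left] at this
  linarith

/-- An eigenvalue with a positive definite left eigenmatrix is the spectral radius: the traces of
the iterates, which control every eigenvalue, grow like its powers. -/
theorem specRad_eq_of_adj_eq {φ : SuperOp D} (hφ : IsPositiveMap φ) {Z : Mat D}
    (hZ : Z ∈ densities D) {c r : ℝ} (hc : 0 < c) (hr : 0 < r)
    (hZc : (Z - (c : ℂ) • (1 : Mat D)).PosSemidef) (heq : adj φ Z = (r : ℂ) • Z) :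
    specRad φ = r := by
  have hpow : ∀ n X, rip Z ((φ ^ n) X) = r ^ n * rip Z X := by
    intro n X
    induction n with
    | zero => simp
    | succ n ih =>
      rw [pow_succ', Module.End.mul_apply, rip_adj, heq, rip_smul_left, ih, pow_succ']
      ring
  have htr : ∀ n, c * rtr ((φ ^ n) 1) ≤ r ^ n := by
    intro n
    have := mul_rtr_le_rip hZc (hφ.pow n 1 PosSemidef.one)
    rwa [hpow, rip_one_right, rtr_of_mem hZ, mul_one] at this
  have hle : ∀ k ∈ spectrum ℂ φ, ‖k‖ ≤ r := by
    intro k hk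
    obtain ⟨A, hA⟩ := (Module.End.hasEigenvalue_iff_mem_spectrum.2 hk).exists_hasEigenvector
    have hAn : ∀ n, (φ ^ n) A = k ^ n • A := fun n => hA.pow_apply n
    obtain ⟨i, j, hij⟩ : ∃ i j, A i j ≠ 0 := by
      by_contra! h
      exact hA.2 (Matrix.ext h)
    obtain ⟨C, hC, hbd⟩ := exists_norm_entry_le A
    have hbd' : ∀ n, (‖k‖ / r) ^ n ≤ C / c / ‖A i j‖ := by
      intro n
      have h1 := hbd (φ ^ n) (hφ.pow n) i j
      rw [hAn, Matrix.smul_apply, norm_smul, norm_pow] at h1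
      rw [div_pow, div_le_iff₀ (by positivity), div_div, div_mul_eq_mul_div,
        le_div_iff₀ (by positivity)]
      nlinarith [mul_le_mul_of_nonneg_left (htr n) hC, mul_le_mul_of_nonneg_left h1 hc.le]
    by_contra! hlt
    obtain ⟨n, hn⟩ := ((tendsto_pow_atTop_atTop_of_one_lt
      ((one_lt_div hr).2 hlt)).eventually_gt_atTop (C / c / ‖A i j‖)).exists
    exact absurd (hbd' n) hn.not_ge
  have hmem : (r : ℂ) ∈ spectrum ℂ φ := by
    rw [spectrum.mem_iff, ← IsUnit.neg_iff, neg_sub]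
    intro hu
    obtain ⟨X, hX⟩ := ((Module.End.isUnit_iff _).1 hu).2 Z
    have hsub : φ X - (r : ℂ) • X = Z := by
      rw [← hX]
      simp [Module.algebraMap_end_apply]
    have h1 : rip Z (φ X - (r : ℂ) • X) = 0 := by
      rw [rip_comm, rip_sub_left, rip_comm, rip_adj, heq, rip_smul_left, rip_smul_left,
        rip_comm X, sub_self]
    rw [hsub] at h1
    have h2 := mul_rtr_le_rip hZc hZ.1
    rw [h1, rtr_of_mem hZ, mul_one] at h2
    exact absurd h2 hc.not_ge
  have hrad : spectralRadius ℂ φ = ENNReal.ofReal r := by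
    refine le_antisymm (iSup₂_le fun k hk => ?_) ?_
    · rw [← enorm_eq_nnnorm, ← ofReal_norm]
      exact ENNReal.ofReal_le_ofReal (hle k hk)
    · refine le_trans ?_ (le_iSup₂ (f := fun k (_ : k ∈ spectrum ℂ φ) => (‖k‖₊ : ℝ≥0∞))
        (r : ℂ) hmem)
      rw [← enorm_eq_nnnorm, ← ofReal_norm, Complex.norm_real, Real.norm_of_nonneg hr.le]
  rw [specRad, hrad, ENNReal.toReal_ofReal hr.le]

theorem IsLeftPerronFrobenius.specRad_eq {φ : SuperOp D} {L : Mat D}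
    (h : IsLeftPerronFrobenius φ L) : specRad φ = rtr (adj φ L) := by
  rw [h.2, rtr_smul, rtr_of_mem h.1, mul_one]

theorem IsLeftPerronFrobenius.normalize_eq {φ : SuperOp D} {L : Mat D}
    (h : IsLeftPerronFrobenius φ L) (hφ : 0 < rtr (adj φ L)) : normalize (adj φ L) = L := by
  rw [h.2, normalize_smul (by rwa [h.specRad_eq]), normalize_of_mem h.1]

theorem exists_isLeftPerronFrobenius_iff (hD : 1 ≤ D) {φ : SuperOp D} (hφ : IsPositiveMap φ)
    (h : IsStrictlyPositive φ) :
    ∃ L ∈ faithfulDensities D, ∀ L', IsLeftPerronFrobenius φ L' ↔ L' = L := by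
  obtain ⟨hnd, δ, hδ, hs⟩ := h.adj_spreads hD hφ
  have hψ : ∀ k : ℕ, IsNondegenerate ((fun _ => adj φ : ℕ → SuperOp D) k) := fun _ => hnd
  have hfwd : fwd (fun _ => adj φ) 1 = adj φ := rfl
  have hfreq : ∃ᶠ m : ℕ in atTop, Spreads (min δ (1 / 2)) (fwd (fun _ => adj φ) 1) :=
    Frequently.of_forall fun _ => by
      rw [hfwd]
      exact hs.mono hnd.pos (min_le_left _ _)
  obtain ⟨Z, hZ⟩ := exists_isLimitState hD hψ (lt_min hδ one_half_pos)
    ((min_le_right _ _).trans_lt one_half_lt_one) hfreq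
  have hZeq : normalize (adj φ Z) = Z := hZ.cons hD hψ hZ
  have hZadj : adj φ Z = (rtr (adj φ Z) : ℂ) • Z := by
    conv_lhs => rw [← hnd.map_eq hZ.1, hZeq]
  have hZδ : (Z - (δ : ℂ) • (1 : Mat D)).PosSemidef := by
    have := hs.sub_posSemidef hnd hZ.1
    rwa [hZeq] at this
  have hrad := specRad_eq_of_adj_eq hφ hZ.1 hδ (hnd.rtr_pos Z hZ.1) hZδ hZadj
  refine ⟨Z, ⟨posDef_of_sub_smul_one hδ hZδ, hZ.1.2⟩, fun L' => ⟨fun hL => ?_, ?_⟩⟩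
  · have hLeq := hL.normalize_eq (hnd.rtr_pos L' hL.1)
    have hfix : ∀ n, normalize (fwd (fun _ => adj φ) n L') = L' := by
      intro n
      induction n with
      | zero => exact normalize_of_mem hL.1
      | succ n ih => rw [fwd, normalize_comp hnd hL.1, hLeq, ih]
    refine tendsto_nhds_unique ?_ (hZ.2 (fun _ => L') (.of_forall fun _ => hL.1))
    simp only [hfix]
    exact tendsto_const_nhds
  · rintro rfl
    exact ⟨hZ.1, by rw [hrad]; exact hZadj⟩

end PerronFrobenius

/-! ### The law of large numbers along a fixed sequence of maps -/

section Growth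

open Matrix

variable {D : ℕ}

theorem log_rtr_comp {φ ψ : SuperOp D} (hφ : IsNondegenerate φ) (hψ : IsNondegenerate ψ)
    {Y : Mat D} (hY : Y ∈ densities D) : Real.log (rtr ((φ ∘ₗ ψ) Y)) =
      Real.log (rtr (ψ Y)) + Real.log (rtr (φ (normalize (ψ Y)))) := by
  rw [← Real.log_mul (hψ.rtr_pos Y hY).ne' (hφ.rtr_pos _ (hψ.normalize_mem hY)).ne', ← rtr_smul,
    ← map_smul, hψ.map_eq hY, LinearMap.comp_apply]

theorem log_rtr_fwd_eq_sum {ψ : ℕ → SuperOp D} (hψ : ∀ k, IsNondegenerate (ψ k))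
    {W : ℕ → Mat D} (hW : ∀ n, W n ∈ densities D)
    (hWψ : ∀ n, normalize (ψ n (W (n + 1))) = W n) (n : ℕ) :
    Real.log (rtr (fwd ψ n (W n))) =
      ∑ k ∈ Finset.range n, Real.log (rtr (ψ k (W (k + 1)))) := by
  induction n with
  | zero => simp [fwd, rtr_of_mem (hW 0)]
  | succ n ih =>
    rw [fwd, log_rtr_comp (isNondegenerate_fwd hψ n) (hψ n) (hW _), hWψ, ih,
      Finset.sum_range_succ, add_comm]

theorem log_rtr_fwd_mem {ψ : ℕ → SuperOp D} (hψ : ∀ k, IsNondegenerate (ψ k)) {b : ℕ → ℝ}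
    (hb : ∀ k, 0 < b k) (hbψ : ∀ k, ∀ Y ∈ densities D, b k ≤ rtr (ψ k Y)) (n : ℕ) {Y : Mat D}
    (hY : Y ∈ densities D) :
    ∑ k ∈ Finset.range n, Real.log (b k) ≤ Real.log (rtr (fwd ψ n Y)) ∧
      Real.log (rtr (fwd ψ n Y)) ≤ ∑ k ∈ Finset.range n, Real.log (rtr (ψ k 1)) := by
  induction n generalizing Y with
  | zero => simp [fwd, rtr_of_mem hY]
  | succ n ih =>
    have h := ih ((hψ n).normalize_mem hY)
    rw [fwd, log_rtr_comp (isNondegenerate_fwd hψ n) (hψ n) hY, Finset.sum_range_succ,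
      Finset.sum_range_succ]
    have h1 := Real.log_le_log (hb n) (hbψ n Y hY)
    have h2 : rtr (ψ n Y) ≤ rtr (ψ n 1) := by
      simpa [rtr_of_mem hY] using (hψ n).pos.rtr_le hY.1
    have h3 := Real.log_le_log ((hψ n).rtr_pos Y hY) h2
    constructor <;> linarith [h.1, h.2]

/-- Two density matrices have comparable images under `φ ∘ ψ` as soon as `ψ` spreads: the
spreading map loses all information but the trace, up to the factor `δ`. -/
theorem log_rtr_comp_le (hD : 1 ≤ D) {φ ψ : SuperOp D} (hφ : IsNondegenerate φ)
    (hψ : IsNondegenerate ψ) {δ : ℝ} (hδ : 0 < δ) (hs : Spreads δ ψ) {Y Y' : Mat D}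
    (hY : Y ∈ densities D) (hY' : Y' ∈ densities D) :
    Real.log (rtr ((φ ∘ₗ ψ) Y)) ≤ Real.log (rtr ((φ ∘ₗ ψ) Y')) +
      (Real.log (rtr (ψ Y)) - Real.log (rtr (ψ Y'))) - Real.log δ := by
  rw [log_rtr_comp hφ hψ hY, log_rtr_comp hφ hψ hY']
  have h1 : rtr (φ (normalize (ψ Y))) ≤ rtr (φ 1) := by
    simpa [rtr_of_mem (hψ.normalize_mem hY)] using hφ.pos.rtr_le (hψ.normalize_mem hY).1
  have h2 : δ * rtr (φ 1) ≤ rtr (φ (normalize (ψ Y'))) := by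
    have := rtr_nonneg (hφ.pos _ (hs.sub_posSemidef hψ hY'))
    rw [map_sub, map_smul, rtr_sub, rtr_smul] at this
    linarith
  have h3 := Real.log_le_log (hφ.rtr_pos _ (hψ.normalize_mem hY)) h1
  have h4 := Real.log_le_log (mul_pos hδ (hφ.rtr_one_pos hD)) h2
  rw [Real.log_mul hδ.ne' (hφ.rtr_one_pos hD).ne'] at h4
  linarith

theorem log_rip_mem {φ : SuperOp D} (hφ : IsNondegenerate φ) {δ : ℝ} (hδ : 0 < δ)
    (hs : Spreads δ φ) {X Y : Mat D} (hX : X ∈ densities D) (hY : Y ∈ densities D) :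
    0 < rip (φ Y) X ∧ Real.log δ + Real.log (rtr (φ Y)) ≤ Real.log (rip (φ Y) X) ∧
      Real.log (rip (φ Y) X) ≤ Real.log (rtr (φ Y)) := by
  have h0 := mul_pos hδ (hφ.rtr_pos Y hY)
  have h1 := hs Y hY X hX
  refine ⟨h0.trans_le h1, ?_, ?_⟩
  · rw [← Real.log_mul hδ.ne' (hφ.rtr_pos Y hY).ne']
    exact Real.log_le_log h0 h1
  · refine Real.log_le_log (h0.trans_le h1) ?_
    simpa [rtr_of_mem hX] using rip_le (hφ.pos Y hY.1) hX.1

theorem tendsto_atTop_of_div_tendsto_one {m : ℕ → ℕ}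
    (hm : Tendsto (fun n => (m n : ℝ) / n) atTop (𝓝 1)) : Tendsto m atTop atTop := by
  have : Tendsto (fun n : ℕ => (m n : ℝ) / n * n) atTop atTop :=
    hm.pos_mul_atTop one_pos tendsto_natCast_atTop_atTop
  refine tendsto_natCast_atTop_iff.1 (this.congr' ?_)
  filter_upwards [eventually_gt_atTop 0] with n hn
  have : (n : ℝ) ≠ 0 := by exact_mod_cast hn.ne'
  field_simp

/-- If the averages of `h` converge and `m n = n - o(n)`, the sum of `h` between `m n` and `n` is
negligible against `n`. -/
theorem tendsto_sum_range_sub_div {h : ℕ → ℝ} {c : ℝ} {m : ℕ → ℕ}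
    (hh : Tendsto (fun n : ℕ => (∑ k ∈ Finset.range n, h k) / n) atTop (𝓝 c))
    (hm : Tendsto (fun n => (m n : ℝ) / n) atTop (𝓝 1)) :
    Tendsto (fun n : ℕ => (∑ k ∈ Finset.range n, h k - ∑ k ∈ Finset.range (m n), h k) / n)
      atTop (𝓝 0) := by
  have hmt := tendsto_atTop_of_div_tendsto_one hm
  have h1 := hh.sub ((hh.comp hmt).mul hm)
  rw [mul_one, sub_self] at h1
  refine h1.congr' ?_
  filter_upwards [eventually_gt_atTop 0, hmt.eventually_gt_atTop 0] with n hn hmn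
  have h2 : (n : ℝ) ≠ 0 := by exact_mod_cast hn.ne'
  have h3 : (m n : ℝ) ≠ 0 := by exact_mod_cast hmn.ne'
  simp only [Function.comp_apply]
  field_simp

/-- The deterministic core of the law of large numbers: the growth rate `l` along a consistent
family `W` of density matrices is the growth rate of all matrix elements, uniformly, if spreading
blocks of a fixed length occur just before time `n`, up to `o(n)`, and the logarithmic
distortions of the single maps have converging averages. -/
theorem exists_uniform_log_rip_bound (hD : 1 ≤ D) {ψ : ℕ → SuperOp D}
    (hψ : ∀ k, IsNondegenerate (ψ k)) {b : ℕ → ℝ} (hb : ∀ k, 0 < b k)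
    (hbψ : ∀ k, ∀ Y ∈ densities D, b k ≤ rtr (ψ k Y)) {W : ℕ → Mat D}
    (hW : ∀ n, W n ∈ densities D) (hWψ : ∀ n, normalize (ψ n (W (n + 1))) = W n) {l c : ℝ}
    (hx : Tendsto (fun n : ℕ => (∑ k ∈ Finset.range n, Real.log (rtr (ψ k (W (k + 1))))) / n)
      atTop (𝓝 l))
    (hh : Tendsto (fun n : ℕ => (∑ k ∈ Finset.range n,
      (Real.log (rtr (ψ k 1)) - Real.log (b k))) / n) atTop (𝓝 c))
    {K : ℕ} {δ : ℝ} (hδ : 0 < δ) {m : ℕ → ℕ}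
    (hm : ∀ᶠ n in atTop, m n + K ≤ n ∧ Spreads δ (fwd (fun j => ψ (m n + j)) K))
    (hm1 : Tendsto (fun n => (m n : ℝ) / n) atTop (𝓝 1))
    {N : ℕ} {δ' : ℝ} (hδ' : 0 < δ') (hN : Spreads δ' (fwd ψ N)) :
    ∃ e : ℕ → ℝ, Tendsto e atTop (𝓝 0) ∧ ∀ᶠ n in atTop, ∀ X ∈ densities D, ∀ Y ∈ densities D,
      0 < rip (fwd ψ n Y) X ∧ |1 / (n : ℝ) * Real.log (rip (fwd ψ n Y) X) - l| ≤ e n := by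
  set x : ℕ → ℝ := fun k => Real.log (rtr (ψ k (W (k + 1))))
  set h : ℕ → ℝ := fun k => Real.log (rtr (ψ k 1)) - Real.log (b k)
  refine ⟨fun n => |(∑ k ∈ Finset.range n, x k) / n - l| + (|Real.log δ| + |Real.log δ'|) / n +
    (∑ k ∈ Finset.range n, h k - ∑ k ∈ Finset.range (m n), h k) / n, ?_, ?_⟩
  · have h1 : Tendsto (fun n : ℕ => |(∑ k ∈ Finset.range n, x k) / n - l|) atTop (𝓝 0) := by
      have := (hx.sub_const l).abs
      rwa [sub_self, abs_zero] at this
    have h2 := (h1.add (tendsto_const_div_atTop_nhds_zero_nat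
      (|Real.log δ| + |Real.log δ'|))).add (tendsto_sum_range_sub_div hh hm1)
    rwa [add_zero, add_zero] at h2
  filter_upwards [hm, eventually_ge_atTop N, eventually_gt_atTop 0]
    with n ⟨hmn, hs⟩ hNn hn0 X hX Y hY
  have hn0' : (0 : ℝ) < n := by exact_mod_cast hn0
  have hnd := isNondegenerate_fwd hψ n
  have hfwdN : Spreads δ' (fwd ψ n) := by
    obtain ⟨k, rfl⟩ := Nat.exists_eq_add_of_le hNn
    rw [fwd_add]
    exact hN.comp (isNondegenerate_fwd (fun j => hψ _) k)
  obtain ⟨hpos, hlow, hupp⟩ := log_rip_mem hnd hδ' hfwdN hX hY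
  refine ⟨hpos, ?_⟩
  have hcmp : ∀ U ∈ densities D, ∀ V ∈ densities D, Real.log (rtr (fwd ψ n U)) ≤
      Real.log (rtr (fwd ψ n V)) + (∑ k ∈ Finset.range n, h k - ∑ k ∈ Finset.range (m n), h k) +
        |Real.log δ| := by
    intro U hU V hV
    obtain ⟨k, hk⟩ := Nat.exists_eq_add_of_le hmn
    have hn : n = m n + (K + k) := by omega
    have hsh : ∀ j, IsNondegenerate (ψ (m n + j)) := fun j => hψ _
    have hsp : Spreads δ (fwd (fun j => ψ (m n + j)) (K + k)) := by
      rw [fwd_add]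
      exact hs.comp (isNondegenerate_fwd (fun j => hsh _) k)
    have h1 := log_rtr_comp_le hD (isNondegenerate_fwd hψ (m n)) (isNondegenerate_fwd hsh (K + k))
      hδ hsp hU hV
    rw [← fwd_add, ← hn] at h1
    have h2 := log_rtr_fwd_mem hsh (fun j => hb (m n + j)) (fun j => hbψ _) (K + k) hU
    have h3 := log_rtr_fwd_mem hsh (fun j => hb (m n + j)) (fun j => hbψ _) (K + k) hV
    have h4 : ∑ k ∈ Finset.range n, h k - ∑ k ∈ Finset.range (m n), h k =
        ∑ j ∈ Finset.range (K + k), Real.log (rtr (ψ (m n + j) 1)) -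
          ∑ j ∈ Finset.range (K + k), Real.log (b (m n + j)) := by
      conv_lhs => rw [hn, Finset.sum_range_add, ← hn]
      rw [add_sub_cancel_left, ← Finset.sum_sub_distrib]
    rw [h4]
    linarith [neg_abs_le (Real.log δ), h2.2, h3.1]
  have hWn := log_rtr_fwd_eq_sum hψ hW hWψ n
  have h1 := hcmp Y hY _ (hW n)
  have h2 := hcmp _ (hW n) Y hY
  rw [hWn] at h1 h2
  have hbase : |Real.log (rip (fwd ψ n Y) X) - ∑ k ∈ Finset.range n, x k| ≤
      |Real.log δ| + |Real.log δ'| +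
        (∑ k ∈ Finset.range n, h k - ∑ k ∈ Finset.range (m n), h k) := by
    have := neg_abs_le (Real.log δ')
    have := abs_nonneg (Real.log δ')
    rw [abs_le]
    constructor <;> linarith
  have hsplit : 1 / (n : ℝ) * Real.log (rip (fwd ψ n Y) X) - l =
      ((∑ k ∈ Finset.range n, x k) / n - l) +
        (Real.log (rip (fwd ψ n Y) X) - ∑ k ∈ Finset.range n, x k) / n := by
    field_simp
    ring
  rw [hsplit, add_assoc, ← add_div]
  refine (abs_add_le _ _).trans ?_
  rw [abs_div, abs_of_pos hn0']
  gcongr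

end Growth

/-! ### Measurability of random maps -/

section Measurability

open Matrix

variable {D : ℕ} {Ω : Type*} [MeasurableSpace Ω]

theorem measurable_superOp_apply {F : Ω → SuperOp D} (hF : Measurable F) (X : Mat D) :
    Measurable fun ω => F ω X := by
  let _ : MeasurableSpace (Mat D →L[ℂ] Mat D) := borel _
  have : BorelSpace (Mat D →L[ℂ] Mat D) := ⟨rfl⟩
  have h1 : Measurable fun φ : SuperOp D => LinearMap.toContinuousLinearMap φ :=
    comap_measurable _
  have h2 : Measurable fun φ : Mat D →L[ℂ] Mat D => φ X := (continuous_eval_const X).measurable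
  exact h2.comp (h1.comp hF)

theorem measurable_entry {A : Ω → Mat D} (hA : Measurable A) (i j : Fin D) :
    Measurable fun ω => A ω i j :=
  (continuous_id.matrix_elem i j).measurable.comp hA

theorem measurable_of_entries {A : Ω → Mat D} (hA : ∀ i j, Measurable fun ω => A ω i j) :
    Measurable A := by
  have : A = fun ω => ∑ i, ∑ j, A ω i j • (Matrix.single i j (1 : ℂ) : Mat D) := by
    ext1 ω
    conv_lhs => rw [matrix_eq_sum_single (A ω)]
    simp [Matrix.smul_single]
  rw [this]
  exact Finset.measurable_fun_sum _ fun i _ => Finset.measurable_fun_sum _ fun j _ =>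
    (hA i j).smul_const _

/-- A pointwise measurable random linear map sends random matrices to random matrices. -/
theorem measurable_apply_random {F : Ω → SuperOp D} (hF : ∀ X, Measurable fun ω => F ω X)
    {A : Ω → Mat D} (hA : Measurable A) : Measurable fun ω => F ω (A ω) := by
  have : (fun ω => F ω (A ω)) =
      fun ω => ∑ i, ∑ j, A ω i j • F ω (Matrix.single i j (1 : ℂ)) := by
    ext1 ω
    conv_lhs => rw [matrix_eq_sum_single (A ω)]
    simp only [map_sum]
    refine Finset.sum_congr rfl fun i _ => Finset.sum_congr rfl fun j _ => ?_
    rw [← mul_one (A ω i j), ← smul_eq_mul, ← Matrix.smul_single, map_smul, smul_eq_mul, mul_one]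
  rw [this]
  exact Finset.measurable_fun_sum _ fun i _ => Finset.measurable_fun_sum _ fun j _ =>
    (measurable_entry hA i j).smul (hF _)

theorem measurable_adj_apply {F : Ω → SuperOp D} (hF : ∀ X, Measurable fun ω => F ω X)
    (X : Mat D) : Measurable fun ω => adj (F ω) X := by
  refine measurable_of_entries fun i j => ?_
  have h : Continuous fun B : Mat D => star (hsInner X B) := by
    unfold hsInner
    fun_prop
  exact h.measurable.comp (hF (Matrix.single i j 1))

theorem measurable_fwd_apply {F : ℕ → Ω → SuperOp D}
    (hF : ∀ k X, Measurable fun ω => F k ω X) (n : ℕ) (X : Mat D) :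
    Measurable fun ω => fwd (fun k => F k ω) n X := by
  induction n generalizing X with
  | zero => exact measurable_const
  | succ n ih => exact measurable_apply_random ih (hF n X)

theorem measurable_rtr {A : Ω → Mat D} (hA : Measurable A) : Measurable fun ω => rtr (A ω) :=
  continuous_rtr.measurable.comp hA

theorem measurable_normalize {A : Ω → Mat D} (hA : Measurable A) :
    Measurable fun ω => normalize (A ω) :=
  (Complex.measurable_ofReal.comp (measurable_rtr hA).inv).smul hA

theorem measurableSet_forall_mem_le {α : Type*} [TopologicalSpace α]
    [TopologicalSpace.PseudoMetrizableSpace α] [SecondCountableTopology α] (S : Set α)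
    {g : Ω → α → ℝ} (hg : ∀ x, Measurable fun ω => g ω x) (hc : ∀ ω, Continuous (g ω)) (a : ℝ) :
    MeasurableSet {ω | ∀ x ∈ S, a ≤ g ω x} := by
  obtain ⟨t, hts, htc, hst⟩ :=
    (TopologicalSpace.IsSeparable.of_separableSpace S).exists_countable_dense_subset
  have : {ω | ∀ x ∈ S, a ≤ g ω x} = ⋂ x ∈ t, {ω | a ≤ g ω x} := by
    ext ω
    simp only [Set.mem_ofPred_eq, Set.mem_iInter]
    refine ⟨fun h x hx => h x (hts hx), fun h x hx => ?_⟩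
    have hcl : IsClosed {x | a ≤ g ω x} := isClosed_le continuous_const (hc ω)
    exact closure_minimal (s := t) h hcl (hst hx)
  rw [this]
  exact MeasurableSet.biInter htc fun x _ => measurableSet_le measurable_const (hg x)

theorem measurableSet_spreads {F : Ω → SuperOp D} (hF : ∀ X, Measurable fun ω => F ω X) (δ : ℝ) :
    MeasurableSet {ω | Spreads δ (F ω)} := by
  have h := measurableSet_forall_mem_le (Ω := Ω) (densities D ×ˢ densities D)
    (g := fun ω p => rip (F ω p.1) p.2 - δ * rtr (F ω p.1)) (fun p => ?_) (fun ω => ?_) 0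
  · convert h using 1
    ext ω
    simp [Spreads]
    tauto
  · have h1 : Continuous fun B : Mat D => rip B p.2 := continuous_rip continuous_id continuous_const
    exact (h1.measurable.comp (hF p.1)).sub ((measurable_rtr (hF p.1)).const_mul δ)
  · have h1 : Continuous fun p : Mat D × Mat D => rtr (F ω p.1) :=
      continuous_rtr.comp ((continuous_superOp (F ω)).comp continuous_fst)
    exact (continuous_rip_superOp (F ω)).sub (h1.const_mul δ)

theorem le_v_iff (hD : 1 ≤ D) {φ : SuperOp D} (hφ : IsPositiveMap φ) (a : ℝ) :
    a ≤ v φ ↔ ∀ X ∈ densities D, a ≤ rtr (φ X) := by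
  refine ⟨fun h X hX => h.trans (v_le hφ hX), fun h => ?_⟩
  refine le_csInf ⟨_, normalize 1, normalize_one_mem hD, rfl⟩ ?_
  rintro _ ⟨X, hX, rfl⟩
  rw [traceNorm_eq_rtr (hφ X hX.1)]
  exact h X hX

theorem measurable_v (hD : 1 ≤ D) {F : Ω → SuperOp D} (hF : ∀ X, Measurable fun ω => F ω X)
    (hpos : ∀ ω, IsPositiveMap (F ω)) : Measurable fun ω => v (F ω) := by
  refine measurable_of_Ici fun a => ?_
  have : (fun ω => v (F ω)) ⁻¹' Set.Ici a = {ω | ∀ X ∈ densities D, a ≤ rtr (F ω X)} := by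
    ext ω
    exact le_v_iff hD (hpos ω) a
  rw [this]
  exact measurableSet_forall_mem_le _ (fun X => measurable_rtr (hF X))
    (fun ω => continuous_rtr.comp (continuous_superOp (F ω))) a

/-! ### Integrability of the logarithmic distortion -/

theorem elog_of_pos {x : ℝ} (hx : 0 < x) : elog x = (Real.log x : EReal) :=
  ENNReal.log_ofReal_of_pos hx

theorem elog_abs_of_pos {x : ℝ} (hx : 0 < x) : (elog x).abs = ENNReal.ofReal |Real.log x| := by
  rw [elog_of_pos hx, EReal.abs_def]

variable {μ : Measure Ω}

/-- If `ln v` has a finite absolute moment then `v` is positive, since `|ln 0| = ∞`. -/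
theorem ae_pos_of_lintegral_elog {w : Ω → ℝ} (hw : Measurable w)
    (h : ∫⁻ ω, (elog (w ω)).abs ∂μ < ⊤) : ∀ᵐ ω ∂μ, 0 < w ω := by
  have hms : MeasurableSet {ω | w ω ≤ 0} := measurableSet_le hw measurable_const
  have h1 : ∫⁻ ω, {ω | w ω ≤ 0}.indicator (fun _ => (⊤ : ℝ≥0∞)) ω ∂μ ≤
      ∫⁻ ω, (elog (w ω)).abs ∂μ := by
    refine lintegral_mono fun ω => ?_
    by_cases hω : w ω ≤ 0
    · have : elog (w ω) = ⊥ := by rw [elog, ENNReal.ofReal_of_nonpos hω, ENNReal.log_zero]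
      simp [this]
    · simp [hω]
  rw [lintegral_indicator_const hms] at h1
  have h2 : μ {ω | w ω ≤ 0} = 0 := by
    by_contra h0
    rw [ENNReal.top_mul h0] at h1
    exact absurd h (not_lt.2 h1)
  rw [ae_iff]
  simpa using h2

theorem integrable_of_lintegral_abs_lt_top {g : Ω → ℝ} (hg : Measurable g)
    (h : ∫⁻ ω, ENNReal.ofReal |g ω| ∂μ < ⊤) : Integrable g μ :=
  ⟨hg.aestronglyMeasurable, by simpa [HasFiniteIntegral, Real.enorm_eq_ofReal_abs] using h⟩

theorem integrable_log_v (hD : 1 ≤ D) {F : Ω → SuperOp D} (hF : ∀ X, Measurable fun ω => F ω X)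
    (hpos : ∀ ω, IsPositiveMap (F ω)) (h_v : ∫⁻ ω, (elog (v (F ω))).abs ∂μ < ⊤) :
    Integrable (fun ω => Real.log (v (F ω))) μ := by
  have hm := measurable_v hD hF hpos
  refine integrable_of_lintegral_abs_lt_top (Real.measurable_log.comp hm) ?_
  rwa [← lintegral_congr_ae]
  filter_upwards [ae_pos_of_lintegral_elog hm h_v] with ω hω
  exact elog_abs_of_pos hω

/-- The trace of `φ 1` is a measurable substitute for the norm of `φ`; its logarithm is
controlled by those of `v φ` and `‖φ‖`. -/
theorem integrable_log_rtr_one [IsFiniteMeasure μ] (hD : 1 ≤ D) {F : Ω → SuperOp D}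
    (hF : ∀ X, Measurable fun ω => F ω X) (hpos : ∀ ω, IsPositiveMap (F ω))
    (h_norm : ∫⁻ ω, (elog (opNorm (F ω))).abs ∂μ < ⊤)
    (h_v : ∫⁻ ω, (elog (v (F ω))).abs ∂μ < ⊤) :
    Integrable (fun ω => Real.log (rtr (F ω 1))) μ := by
  have hD' : (0 : ℝ) < D := by exact_mod_cast hD
  have hX₀ := normalize_one_mem hD
  have hone : ∀ ω, rtr (F ω 1) = D * rtr (F ω (normalize 1)) := by
    intro ω
    have h1 : (0 : ℝ) < rtr (1 : Mat D) := by rwa [rtr_one]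
    conv_lhs => rw [← rtr_smul_normalize h1, map_smul, rtr_smul, rtr_one]
  have hvint := integrable_log_v hD hF hpos h_v
  refine integrable_of_lintegral_abs_lt_top
    (Real.measurable_log.comp (measurable_rtr (hF 1))) ?_
  obtain ⟨C, -, hC⟩ := exists_opNorm_le (D := D)
  have hbound : ∀ᵐ ω ∂μ, ENNReal.ofReal |Real.log (rtr (F ω 1))| ≤
      ENNReal.ofReal (|Real.log D| + |Real.log (v (F ω))|) + (elog (opNorm (F ω))).abs := by
    filter_upwards [ae_pos_of_lintegral_elog (measurable_v hD hF hpos) h_v] with ω hω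
    have h1 := v_le (hpos ω) hX₀
    have h2 := (hC _ (hpos ω)).2 _ hX₀
    have h3 : 0 < rtr (F ω (normalize 1)) := hω.trans_le h1
    rw [elog_abs_of_pos (h3.trans_le h2), ← ENNReal.ofReal_add (by positivity) (abs_nonneg _),
      hone, Real.log_mul hD'.ne' h3.ne']
    refine ENNReal.ofReal_le_ofReal ?_
    have h4 := Real.log_le_log hω h1
    have h5 := Real.log_le_log h3 h2
    have h6 : |Real.log (rtr (F ω (normalize 1)))| ≤
        |Real.log (v (F ω))| + |Real.log (opNorm (F ω))| := by
      rw [abs_le]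
      constructor <;> linarith [neg_abs_le (Real.log (v (F ω))),
        le_abs_self (Real.log (opNorm (F ω))),
        abs_nonneg (Real.log (v (F ω))), abs_nonneg (Real.log (opNorm (F ω)))]
    linarith [abs_add_le (Real.log D) (Real.log (rtr (F ω (normalize 1))))]
  refine (lintegral_mono_ae hbound).trans_lt ?_
  rw [lintegral_add_left]
  · refine ENNReal.add_lt_top.2 ⟨?_, h_norm⟩
    have := ((integrable_const (|Real.log D|)).add hvint.abs).lintegral_lt_top
    simpa using this
  · exact (measurable_const.add
      (Real.measurable_log.comp (measurable_v hD hF hpos)).norm).ennreal_ofReal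

end Measurability

/-! ### Passage to extended real logarithms -/

section ERealLimits

/-- Quantities comparable to `u n` have the exponential growth rate of `u n`. -/
theorem tendsto_elog_of_comparable {u w : ℕ → ℝ} {l c C : ℝ} (hc : 0 < c) (hC : 0 < C)
    (hu : ∀ᶠ n in atTop, 0 < u n) (hcu : ∀ᶠ n in atTop, c * u n ≤ w n)
    (hCu : ∀ᶠ n in atTop, w n ≤ C * u n)
    (hl : Tendsto (fun n : ℕ => 1 / (n : ℝ) * Real.log (u n)) atTop (𝓝 l)) :
    Tendsto (fun n : ℕ => ((1 / (n : ℝ) : ℝ) : EReal) * elog (w n)) atTop (𝓝 (l : EReal)) := by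
  have key : ∀ a : ℝ, 0 < a →
      Tendsto (fun n : ℕ => 1 / (n : ℝ) * Real.log (a * u n)) atTop (𝓝 l) := by
    intro a ha
    have h1 := (tendsto_one_div_atTop_nhds_zero_nat.mul_const (Real.log a)).add hl
    rw [zero_mul, zero_add] at h1
    refine h1.congr' ?_
    filter_upwards [hu] with n hn
    rw [Real.log_mul ha.ne' hn.ne', mul_add]
  have hw : Tendsto (fun n : ℕ => 1 / (n : ℝ) * Real.log (w n)) atTop (𝓝 l) := by
    refine tendsto_of_tendsto_of_tendsto_of_le_of_le' (key c hc) (key C hC) ?_ ?_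
    · filter_upwards [hu, hcu] with n h1 h2
      have := Real.log_le_log (mul_pos hc h1) h2
      gcongr
    · filter_upwards [hu, hcu, hCu] with n h1 h2 h3
      have := Real.log_le_log ((mul_pos hc h1).trans_le h2) h3
      gcongr
  refine ((continuous_coe_real_ereal.tendsto l).comp hw).congr' ?_
  filter_upwards [hu, hcu] with n h1 h2
  rw [elog_of_pos ((mul_pos hc h1).trans_le h2), Function.comp_apply, EReal.coe_mul]

end ERealLimits

/-! ### The dual cocycle over an ergodic map -/

section Cocycle

open Matrix

variable {D : ℕ} {Ω : Type*} {θ : Ω → Ω} {φ₀ : Ω → SuperOp D}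

/-- The sequence `k ↦ φ_{k;ω}*` of the adjoint maps along the orbit of `ω`. -/
noncomputable def dualSeq (θ : Ω → Ω) (φ₀ : Ω → SuperOp D) (ω : Ω) (k : ℕ) : SuperOp D :=
  adj (φ₀ (θ^[k] ω))

theorem dualSeq_iterate (m : ℕ) (ω : Ω) :
    dualSeq θ φ₀ (θ^[m] ω) = fun j => dualSeq θ φ₀ ω (m + j) := by
  ext1 j
  rw [dualSeq, dualSeq, add_comm, Function.iterate_add_apply]

theorem dualSeq_apply_base (ω : Ω) :
    dualSeq θ φ₀ (θ ω) = fun j => dualSeq θ φ₀ ω (j + 1) := by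
  ext1 j
  rw [dualSeq, dualSeq, Function.iterate_succ_apply]

/-- `Φ^(n)` involves `φ₁, …, φₙ`, hence the orbit of `θ ω`. -/
theorem adj_prodMap (n : ℕ) (ω : Ω) :
    adj (prodMap θ φ₀ n ω) = fwd (dualSeq θ φ₀ (θ ω)) n := by
  induction n with
  | zero => exact adj_id
  | succ n ih => rw [prodMap, adj_comp, ih, fwd, dualSeq, ← Function.iterate_succ_apply]

theorem isPositiveMap_prodMap (hpos : ∀ ω, IsPositiveMap (φ₀ ω)) (n : ℕ) (ω : Ω) :
    IsPositiveMap (prodMap θ φ₀ n ω) := by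
  induction n with
  | zero => exact fun _ h => h
  | succ n ih => exact IsPositiveMap.comp (hpos _) ih

theorem exists_of_tau_lt_top {ω : Ω} (h : tau θ φ₀ ω < ⊤) :
    ∃ n, ∀ k, IsStrictlyPositive (prodMap θ φ₀ (n + k) ω) := by
  by_contra! hcon
  refine h.ne ?_
  simp only [tau, iInf_eq_top]
  rintro n ⟨-, hn⟩
  obtain ⟨k, hk⟩ := hcon n
  exact absurd (hn k) hk

/-- A quantitative form of "some initial product is strictly positive", for the dual cocycle
started at `ω`. The constants `1 / (j + 2)` are a countable family of numbers in `(0, 1)` that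
accumulate at `0`. -/
def EventuallySpreads (θ : Ω → Ω) (φ₀ : Ω → SuperOp D) (ω : Ω) : Prop :=
  ∃ K j : ℕ, Spreads (1 / ((j : ℝ) + 2)) (fwd (dualSeq θ φ₀ ω) K)

theorem eventuallySpreads_of_tau (hD : 1 ≤ D) (hpos : ∀ ω, IsPositiveMap (φ₀ ω)) {ω : Ω}
    (h : tau θ φ₀ ω < ⊤) : EventuallySpreads θ φ₀ (θ ω) := by
  obtain ⟨n, hn⟩ := exists_of_tau_lt_top h
  obtain ⟨hnd, δ, hδ, hs⟩ := (hn 0).adj_spreads hD (isPositiveMap_prodMap hpos _ ω)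
  rw [adj_prodMap] at hnd hs
  obtain ⟨j, hj⟩ := exists_nat_one_div_lt hδ
  refine ⟨n + 0, j, hs.mono hnd.pos (le_trans ?_ hj.le)⟩
  gcongr
  norm_num

/-- The density matrices that dominate a multiple `1 / (j + 1)` of the identity for some `j`;
a Borel set of positive definite matrices. -/
def boundedBelow (D : ℕ) : Set (Mat D) :=
  densities D ∩ ⋃ j : ℕ, {A | (A - ((1 / ((j : ℝ) + 1) : ℝ) : ℂ) • (1 : Mat D)).PosSemidef}

theorem boundedBelow_subset : boundedBelow D ⊆ faithfulDensities D := by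
  rintro A ⟨hA, hA'⟩
  obtain ⟨j, hj⟩ := Set.mem_iUnion.1 hA'
  exact ⟨posDef_of_sub_smul_one Nat.one_div_pos_of_nat hj, hA.2⟩

theorem measurableSet_boundedBelow : MeasurableSet (boundedBelow D) := by
  refine isClosed_densities.measurableSet.inter (MeasurableSet.iUnion fun j => ?_)
  have h : Continuous fun A : Mat D => A - ((1 / ((j : ℝ) + 1) : ℝ) : ℂ) • (1 : Mat D) :=
    continuous_id.sub continuous_const
  exact (isClosed_posSemidef.preimage h).measurableSet

theorem normalize_one_mem_boundedBelow (hD : 1 ≤ D) : normalize (1 : Mat D) ∈ boundedBelow D := by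
  refine ⟨normalize_one_mem hD, Set.mem_iUnion.2 ⟨D, ?_⟩⟩
  have h1 : normalize (1 : Mat D) - ((1 / ((D : ℝ) + 1) : ℝ) : ℂ) • (1 : Mat D) =
      (((D : ℝ)⁻¹ - 1 / ((D : ℝ) + 1) : ℝ) : ℂ) • (1 : Mat D) := by
    rw [normalize, rtr_one, ← sub_smul]
    push_cast
    rfl
  have hD' : (0 : ℝ) < D := by exact_mod_cast hD
  have h2 : 1 / ((D : ℝ) + 1) ≤ (D : ℝ)⁻¹ := by
    rw [one_div]
    exact inv_anti₀ hD' (by linarith)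
  change (_ - _ : Mat D).PosSemidef
  rw [h1]
  exact posSemidef_smul PosSemidef.one (sub_nonneg.2 h2)

theorem IsLimitState.mem_boundedBelow (hD : 1 ≤ D) {ω : Ω}
    (hnd : ∀ k, IsNondegenerate (dualSeq θ φ₀ ω k)) (hs : EventuallySpreads θ φ₀ ω) {Z : Mat D}
    (hZ : IsLimitState (dualSeq θ φ₀ ω) Z) : Z ∈ boundedBelow D := by
  obtain ⟨K, j, hj⟩ := hs
  refine ⟨hZ.1, Set.mem_iUnion.2 ⟨j + 1, ?_⟩⟩
  have := hZ.sub_posSemidef hD hnd hj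
  change (_ - _ : Mat D).PosSemidef
  convert this using 4
  push_cast
  ring

theorem IsLimitState.normalize_adj (hD : 1 ≤ D) {ω : Ω} {Z Z' : Mat D}
    (hZ : IsLimitState (dualSeq θ φ₀ ω) Z) (hnd : ∀ k, IsNondegenerate (dualSeq θ φ₀ ω k))
    (hZ' : IsLimitState (dualSeq θ φ₀ (θ ω)) Z') : normalize (adj (φ₀ ω) Z') = Z := by
  rw [dualSeq_apply_base] at hZ'
  exact hZ.cons hD hnd hZ'

variable [MeasurableSpace Ω] {μ : Measure Ω}

theorem ae_forall_iterate (hθ : Measure.QuasiMeasurePreserving θ μ μ) {P : Ω → Prop}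
    (h : ∀ᵐ ω ∂μ, P ω) : ∀ᵐ ω ∂μ, ∀ k : ℕ, P (θ^[k] ω) :=
  ae_all_iff.2 fun k => (hθ.iterate k).ae h

theorem measurable_dualSeq_apply (hθ : Measurable θ) (hmeas : Measurable φ₀) (k : ℕ) (X : Mat D) :
    Measurable fun ω => dualSeq θ φ₀ ω k X :=
  (measurable_adj_apply (measurable_superOp_apply hmeas) X).comp (hθ.iterate k)

theorem measurableSet_spreads_fwd (hθ : Measurable θ) (hmeas : Measurable φ₀) (K : ℕ) (δ : ℝ) :
    MeasurableSet {ω | Spreads δ (fwd (dualSeq θ φ₀ ω) K)} :=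
  measurableSet_spreads (measurable_fwd_apply (F := fun k ω => dualSeq θ φ₀ ω k)
    (measurable_dualSeq_apply hθ hmeas) K) δ

/-- The property holds along `θ ω` by assumption on `tau`; invariance of the measure removes the
shift, which matters since `θ` need not be invertible. -/
theorem ae_eventuallySpreads (hθ : MeasurePreserving θ μ μ) (hD : 1 ≤ D)
    (hmeas : Measurable φ₀) (hpos : ∀ ω, IsPositiveMap (φ₀ ω))
    (h_tau : ∀ᵐ ω ∂μ, tau θ φ₀ ω < ⊤) : ∀ᵐ ω ∂μ, EventuallySpreads θ φ₀ ω := by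
  have hms : MeasurableSet {ω | EventuallySpreads θ φ₀ ω} := by
    have : {ω | EventuallySpreads θ φ₀ ω} =
        ⋃ K : ℕ, ⋃ j : ℕ, {ω | Spreads (1 / ((j : ℝ) + 2)) (fwd (dualSeq θ φ₀ ω) K)} := by
      ext ω
      simp [EventuallySpreads]
    rw [this]
    exact MeasurableSet.iUnion fun K => MeasurableSet.iUnion fun j =>
      measurableSet_spreads_fwd hθ.measurable hmeas K _
  have h1 : ∀ᵐ ω ∂μ, EventuallySpreads θ φ₀ (θ ω) :=
    h_tau.mono fun ω hω => eventuallySpreads_of_tau hD hpos hω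
  rw [← hθ.map_eq]
  exact (ae_map_iff hθ.measurable.aemeasurable hms).2 h1

/-- A spreading block of some fixed length and strength recurs along almost every orbit, at times
that lag only `o(n)` behind `n`. -/
theorem exists_recurrent_spreads [IsProbabilityMeasure μ] (hθ : Ergodic θ μ) (hD : 1 ≤ D)
    (hmeas : Measurable φ₀) (hpos : ∀ ω, IsPositiveMap (φ₀ ω))
    (h_tau : ∀ᵐ ω ∂μ, tau θ φ₀ ω < ⊤) : ∃ (K : ℕ) (δ : ℝ), 0 < δ ∧ δ < 1 ∧
      ∀ᵐ ω ∂μ, ∃ m : ℕ → ℕ, (∀ᶠ n in atTop, m n + K ≤ n ∧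
        Spreads δ (fwd (fun j => dualSeq θ φ₀ ω (m n + j)) K)) ∧
          Tendsto (fun n => (m n : ℝ) / n) atTop (𝓝 1) := by
  obtain ⟨K, j, hKj⟩ : ∃ K j : ℕ,
      μ {ω | Spreads (1 / ((j : ℝ) + 2)) (fwd (dualSeq θ φ₀ ω) K)} ≠ 0 := by
    by_contra! hcon
    have h1 : ∀ᵐ ω ∂μ, ∀ K j : ℕ, ¬ Spreads (1 / ((j : ℝ) + 2)) (fwd (dualSeq θ φ₀ ω) K) :=
      ae_all_iff.2 fun K => ae_all_iff.2 fun j => by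
        rw [ae_iff]
        simpa using hcon K j
    obtain ⟨ω, ⟨K, j, hs⟩, hn⟩ :=
      ((ae_eventuallySpreads hθ.toMeasurePreserving hD hmeas hpos h_tau).and h1).exists
    exact hn K j hs
  refine ⟨K, 1 / ((j : ℝ) + 2), by positivity, ?_, ?_⟩
  · rw [div_lt_one (by positivity)]
    linarith [(Nat.cast_nonneg j : (0 : ℝ) ≤ j)]
  filter_upwards [ae_exists_visit_sequence hθ
    (measurableSet_spreads_fwd hθ.measurable hmeas K _) hKj K] with ω ⟨m, hm, hm1⟩
  refine ⟨m, hm.mono fun n hn => ⟨hn.1, ?_⟩, hm1⟩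
  have h2 : Spreads (1 / ((j : ℝ) + 2)) (fwd (dualSeq θ φ₀ (θ^[m n] ω)) K) := hn.2
  rwa [dualSeq_iterate] at h2

theorem ae_isNondegenerate (hθ : MeasurePreserving θ μ μ) (hD : 1 ≤ D) (hmeas : Measurable φ₀)
    (hpos : ∀ ω, IsPositiveMap (φ₀ ω)) (h_v : ∫⁻ ω, (elog (v (adj (φ₀ ω)))).abs ∂μ < ⊤) :
    ∀ᵐ ω ∂μ, ∀ k, 0 < v (dualSeq θ φ₀ ω k) ∧ IsNondegenerate (dualSeq θ φ₀ ω k) := by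
  have hm := measurable_v hD (measurable_adj_apply (measurable_superOp_apply hmeas))
    fun ω => (hpos ω).adj
  filter_upwards [ae_forall_iterate hθ.quasiMeasurePreserving (ae_pos_of_lintegral_elog hm h_v)]
    with ω hω k
  exact ⟨hω k, (hpos _).adj, fun X hX => (hω k).trans_le (v_le (hpos _).adj hX)⟩

/-- The limit state of the dual cocycle started at `ω`, as a random variable. -/
theorem exists_measurable_limitState [IsProbabilityMeasure μ] (hθ : Ergodic θ μ) (hD : 1 ≤ D)
    (hmeas : Measurable φ₀) (hpos : ∀ ω, IsPositiveMap (φ₀ ω))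
    (h_tau : ∀ᵐ ω ∂μ, tau θ φ₀ ω < ⊤) (h_v : ∫⁻ ω, (elog (v (adj (φ₀ ω)))).abs ∂μ < ⊤) :
    ∃ Z₀ : Ω → Mat D, Measurable Z₀ ∧ (∀ ω, Z₀ ω ∈ faithfulDensities D) ∧
      ∀ᵐ ω ∂μ, IsLimitState (dualSeq θ φ₀ ω) (Z₀ ω) := by
  classical
  obtain ⟨K, δ, hδ0, hδ1, hrec⟩ := exists_recurrent_spreads hθ hD hmeas hpos h_tau
  have hnd := ae_isNondegenerate hθ.toMeasurePreserving hD hmeas hpos h_v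
  have hex : ∀ᵐ ω ∂μ, ∃ Z, IsLimitState (dualSeq θ φ₀ ω) Z := by
    filter_upwards [hrec, hnd] with ω ⟨m, hm, hm1⟩ hω
    refine exists_isLimitState hD (fun k => (hω k).2) hδ0 hδ1 (K := K) ?_
    exact (tendsto_atTop_of_div_tendsto_one hm1).frequently
      (p := fun k => Spreads δ (fwd (fun j => dualSeq θ φ₀ ω (k + j)) K))
      (hm.mono fun n hn => hn.2).frequently
  set z : Ω → Mat D := fun ω => Classical.epsilon fun Z => IsLimitState (dualSeq θ φ₀ ω) Z
  have hzlim : ∀ᵐ ω ∂μ, IsLimitState (dualSeq θ φ₀ ω) (z ω) :=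
    hex.mono fun ω hω => Classical.epsilon_spec hω
  have hzm : AEMeasurable z μ := by
    refine aemeasurable_of_tendsto_metrizable_ae atTop
      (f := fun n ω => normalize (fwd (dualSeq θ φ₀ ω) n (normalize 1))) (fun n => ?_) ?_
    · exact (measurable_normalize (measurable_fwd_apply (F := fun k ω => dualSeq θ φ₀ ω k)
        (measurable_dualSeq_apply hθ.measurable hmeas) n _)).aemeasurable
    · exact hzlim.mono fun ω hω => hω.2 _ (.of_forall fun _ => normalize_one_mem hD)
  -- the measurable version is redefined off a full-measure set so that every value is faithful
  refine ⟨fun ω => if hzm.mk z ω ∈ boundedBelow D then hzm.mk z ω else normalize 1, ?_, ?_, ?_⟩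
  · exact Measurable.ite (hzm.measurable_mk measurableSet_boundedBelow) hzm.measurable_mk
      measurable_const
  · intro ω
    refine boundedBelow_subset ?_
    dsimp only
    split_ifs with h
    · exact h
    · exact normalize_one_mem_boundedBelow hD
  · filter_upwards [hzm.ae_eq_mk, hzlim, hnd,
      ae_eventuallySpreads hθ.toMeasurePreserving hD hmeas hpos h_tau] with ω h1 h2 h3 h4
    rw [← h1, if_pos (h2.mem_boundedBelow hD (fun k => (h3 k).2) h4)]
    exact h2

theorem integrable_log_rtr_limitState [IsProbabilityMeasure μ] (hD : 1 ≤ D) {F : Ω → SuperOp D}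
    (hF : ∀ X, Measurable fun ω => F ω X) (hpos : ∀ ω, IsPositiveMap (F ω))
    (h_norm : ∫⁻ ω, (elog (opNorm (F ω))).abs ∂μ < ⊤)
    (h_v : ∫⁻ ω, (elog (v (F ω))).abs ∂μ < ⊤) {Z : Ω → Mat D} (hZ : Measurable Z)
    (hZd : ∀ ω, Z ω ∈ densities D) :
    Measurable (fun ω => Real.log (rtr (F ω (Z ω)))) ∧
      Integrable (fun ω => Real.log (rtr (F ω (Z ω)))) μ := by
  have hm : Measurable (fun ω => Real.log (rtr (F ω (Z ω)))) :=
    Real.measurable_log.comp (measurable_rtr (measurable_apply_random hF hZ))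
  refine ⟨hm, ?_⟩
  have h1 := integrable_log_v hD hF hpos h_v
  have h2 := integrable_log_rtr_one hD hF hpos h_norm h_v
  refine (h1.abs.add h2.abs).mono' hm.aestronglyMeasurable ?_
  filter_upwards [ae_pos_of_lintegral_elog (measurable_v hD hF hpos) h_v] with ω hω
  have h3 := v_le (hpos ω) (hZd ω)
  have h4 := (hpos ω).rtr_le (hZd ω).1
  rw [rtr_of_mem (hZd ω), one_mul] at h4
  have h5 := Real.log_le_log hω h3
  have h6 := Real.log_le_log (hω.trans_le h3) h4
  rw [Real.norm_eq_abs, abs_le, Pi.add_apply]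
  constructor <;> linarith [neg_abs_le (Real.log (v (F ω))), le_abs_self (Real.log (rtr (F ω 1))),
    abs_nonneg (Real.log (v (F ω))), abs_nonneg (Real.log (rtr (F ω 1)))]

/-- The law of large numbers for the dual cocycle, uniformly over pairs of density matrices. -/
theorem ae_exists_uniform_log_rip_bound [IsProbabilityMeasure μ] (hθ : Ergodic θ μ) (hD : 1 ≤ D)
    (hmeas : Measurable φ₀) (hpos : ∀ ω, IsPositiveMap (φ₀ ω))
    (h_tau : ∀ᵐ ω ∂μ, tau θ φ₀ ω < ⊤)
    (h_norm : ∫⁻ ω, (elog (opNorm (adj (φ₀ ω)))).abs ∂μ < ⊤)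
    (h_v : ∫⁻ ω, (elog (v (adj (φ₀ ω)))).abs ∂μ < ⊤) {Z₀ : Ω → Mat D} (hZm : Measurable Z₀)
    (hZd : ∀ ω, Z₀ ω ∈ densities D) (hZ : ∀ᵐ ω ∂μ, IsLimitState (dualSeq θ φ₀ ω) (Z₀ ω)) :
    ∀ᵐ ω ∂μ, ∃ e : ℕ → ℝ, Tendsto e atTop (𝓝 0) ∧
      ∀ᶠ n in atTop, ∀ X ∈ densities D, ∀ Y ∈ densities D,
        0 < rip (fwd (dualSeq θ φ₀ ω) n Y) X ∧
          |1 / (n : ℝ) * Real.log (rip (fwd (dualSeq θ φ₀ ω) n Y) X) -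
            ∫ ω, Real.log (rtr (adj (φ₀ ω) (Z₀ (θ ω)))) ∂μ| ≤ e n := by
  have hF := measurable_adj_apply (measurable_superOp_apply hmeas)
  have hposF : ∀ ω, IsPositiveMap (adj (φ₀ ω)) := fun ω => (hpos ω).adj
  obtain ⟨K, δ, hδ0, hδ1, hrec⟩ := exists_recurrent_spreads hθ hD hmeas hpos h_tau
  obtain ⟨hfm, hfi⟩ := integrable_log_rtr_limitState hD hF hposF h_norm h_v
    (hZm.comp hθ.measurable) fun ω => hZd (θ ω)
  have hhm : Measurable fun ω => Real.log (rtr (adj (φ₀ ω) 1)) - Real.log (v (adj (φ₀ ω))) :=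
    (Real.measurable_log.comp (measurable_rtr (hF 1))).sub
      (Real.measurable_log.comp (measurable_v hD hF hposF))
  have hhi : Integrable (fun ω => Real.log (rtr (adj (φ₀ ω) 1)) - Real.log (v (adj (φ₀ ω)))) μ :=
    (integrable_log_rtr_one hD hF hposF h_norm h_v).sub (integrable_log_v hD hF hposF h_v)
  filter_upwards [hrec, ae_isNondegenerate hθ.toMeasurePreserving hD hmeas hpos h_v,
    ae_eventuallySpreads hθ.toMeasurePreserving hD hmeas hpos h_tau,
    ae_forall_iterate hθ.quasiMeasurePreserving hZ, ae_tendsto_birkhoffAverage hθ hfm hfi,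
    ae_tendsto_birkhoffAverage hθ hhm hhi] with ω ⟨m, hm, hm1⟩ hnd ⟨N, j, hN⟩ hlim hx hh
  have havg : ∀ (f : Ω → ℝ) (n : ℕ), birkhoffAverage ℝ θ f n ω =
      (∑ k ∈ Finset.range n, f (θ^[k] ω)) / n := fun f n => by
    rw [birkhoffAverage, smul_eq_mul, inv_mul_eq_div, birkhoffSum]
  simp only [havg] at hx hh
  refine exists_uniform_log_rip_bound hD (fun k => (hnd k).2) (b := fun k => v (dualSeq θ φ₀ ω k))
    (fun k => (hnd k).1) (fun k Y hY => v_le (hnd k).2.pos hY) (W := fun k => Z₀ (θ^[k] ω))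
    (fun k => hZd _) (fun k => ?_) ?_ hh hδ0 hm hm1 (by positivity) hN
  · have h2 := hlim (k + 1)
    rw [Function.iterate_succ_apply'] at h2 ⊢
    refine (hlim k).normalize_adj hD (fun i => ?_) h2
    rw [dualSeq_iterate]
    exact (hnd _).2
  · refine hx.congr fun n => ?_
    congr 1
    refine Finset.sum_congr rfl fun k _ => ?_
    rw [dualSeq, Function.iterate_succ_apply']
    rfl

end Cocycle

/-! ### Asymptotics of the forward products -/

section Forward

variable {D : ℕ}

theorem rip_normalize_one (A : Mat D) : rip A (normalize 1) = (D : ℝ)⁻¹ * rtr A := by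
  rw [normalize, rip_smul_right, rip_one_right, rtr_one]

theorem opNorm_comparable (hD : 1 ≤ D) : ∃ c C : ℝ, 0 < c ∧ 0 < C ∧ ∀ φ : SuperOp D,
    IsPositiveMap φ → c * rip (adj φ (normalize 1)) (normalize 1) ≤ opNorm φ ∧
      opNorm φ ≤ C * rip (adj φ (normalize 1)) (normalize 1) := by
  have hD' : (0 : ℝ) < D := by exact_mod_cast hD
  obtain ⟨C, hC0, hC⟩ := exists_opNorm_le (D := D)
  refine ⟨D, (C + 1) * D ^ 2, hD', by positivity, fun φ hφ => ?_⟩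
  have h0 : 0 ≤ rtr (φ 1) := rtr_nonneg (hφ _ Matrix.PosSemidef.one)
  have h1 : rip (adj φ (normalize 1)) (normalize 1) = (D : ℝ)⁻¹ * rtr (φ (normalize 1)) := by
    rw [← rip_adj, rip_comm, rip_normalize_one]
  have h2 : rtr (φ (normalize 1)) = (D : ℝ)⁻¹ * rtr (φ 1) := by
    rw [normalize, map_smul, rtr_smul, rtr_one]
  obtain ⟨h3, h4⟩ := hC φ hφ
  rw [h1]
  constructor
  · rw [mul_inv_cancel_left₀ hD'.ne']
    exact h4 _ (normalize_one_mem hD)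
  · rw [h2]
    have : (C + 1) * (D : ℝ) ^ 2 * ((D : ℝ)⁻¹ * ((D : ℝ)⁻¹ * rtr (φ 1))) = (C + 1) * rtr (φ 1) := by
      field_simp
    rw [this]
    linarith

/-- A uniform real estimate for the logarithms of the matrix elements bounds the supremum of the
extended real deviations. -/
theorem tendsto_iSup_elog_sub_abs {Φ : ℕ → SuperOp D} {l : ℝ} {e : ℕ → ℝ}
    (he : Tendsto e atTop (𝓝 0))
    (h : ∀ᶠ n in atTop, ∀ X ∈ densities D, ∀ Y ∈ densities D, 0 < rip (adj (Φ n) Y) X ∧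
      |1 / (n : ℝ) * Real.log (rip (adj (Φ n) Y) X) - l| ≤ e n) :
    Tendsto (fun n : ℕ => ⨆ X ∈ densities D, ⨆ Y ∈ densities D,
      (((1 / (n : ℝ) : ℝ) : EReal) * elog (hsInner Y (Φ n X)).re - (l : EReal)).abs)
      atTop (𝓝 (0 : ℝ≥0∞)) := by
  have he' : Tendsto (fun n => ENNReal.ofReal (e n)) atTop (𝓝 0) := by
    have h0 := (ENNReal.continuous_ofReal.tendsto 0).comp he
    rwa [ENNReal.ofReal_zero] at h0
  refine tendsto_of_tendsto_of_tendsto_of_le_of_le' tendsto_const_nhds he'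
    (.of_forall fun _ => bot_le) ?_
  filter_upwards [h] with n hn
  refine iSup₂_le fun X hX => iSup₂_le fun Y hY => ?_
  obtain ⟨h1, h2⟩ := hn X hX Y hY
  rw [hsInner_adj]
  change (_ * elog (rip (adj (Φ n) Y) X) - _ : EReal).abs ≤ _
  rw [elog_of_pos h1, ← EReal.coe_mul, ← EReal.coe_sub, EReal.abs_def]
  exact ENNReal.ofReal_le_ofReal h2

theorem tendsto_one_div_mul_log {Φ : ℕ → SuperOp D} {l : ℝ} {e : ℕ → ℝ}
    (he : Tendsto e atTop (𝓝 0))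
    (h : ∀ᶠ n in atTop, ∀ X ∈ densities D, ∀ Y ∈ densities D, 0 < rip (adj (Φ n) Y) X ∧
      |1 / (n : ℝ) * Real.log (rip (adj (Φ n) Y) X) - l| ≤ e n) {X Y : ℕ → Mat D}
    (hX : ∀ᶠ n in atTop, X n ∈ densities D) (hY : ∀ᶠ n in atTop, Y n ∈ densities D) :
    (∀ᶠ n in atTop, 0 < rip (adj (Φ n) (Y n)) (X n)) ∧
      Tendsto (fun n : ℕ => 1 / (n : ℝ) * Real.log (rip (adj (Φ n) (Y n)) (X n))) atTop (𝓝 l) := by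
  refine ⟨?_, ?_⟩
  · filter_upwards [h, hX, hY] with n hn hXn hYn
    exact (hn _ hXn _ hYn).1
  · rw [tendsto_iff_dist_tendsto_zero]
    refine squeeze_zero' (.of_forall fun _ => dist_nonneg) ?_ he
    filter_upwards [h, hX, hY] with n hn hXn hYn
    exact (hn _ hXn _ hYn).2

end Forward

end PosProd

theorem theorem1 {D : ℕ} (hD : 1 ≤ D) {Ω : Type*} [MeasurableSpace Ω]
    (μ : Measure Ω) [IsProbabilityMeasure μ]
    (θ : Ω → Ω) (hθ : Ergodic θ μ)
    (φ₀ : Ω → PosProd.SuperOp D) (hmeas : Measurable φ₀)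
    (hpos : ∀ ω, PosProd.IsPositiveMap (φ₀ ω))
    (h_tau : ∀ᵐ ω ∂μ, PosProd.tau θ φ₀ ω < ⊤)
    (h_norm : ∫⁻ ω, (PosProd.elog (PosProd.opNorm (PosProd.adj (φ₀ ω)))).abs ∂μ < ⊤)
    (h_v : ∫⁻ ω, (PosProd.elog (PosProd.v (PosProd.adj (φ₀ ω)))).abs ∂μ < ⊤) :
    ∃ (L : ℕ → Ω → PosProd.Mat D) (Z₁ : Ω → PosProd.Mat D) (l : ℝ),
      -- `L n` is, for large `n`, the unique left Perron-Frobenius eigenmatrix, and `Z₁ = lim L n`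
      (∀ᵐ ω ∂μ, ∀ᶠ n in atTop, L n ω ∈ PosProd.faithfulDensities D ∧
        ∀ L' : PosProd.Mat D,
          PosProd.IsLeftPerronFrobenius (PosProd.prodMap θ φ₀ n ω) L' ↔ L' = L n ω) ∧
      Measurable Z₁ ∧ (∀ ω, Z₁ ω ∈ PosProd.faithfulDensities D) ∧
      (∀ᵐ ω ∂μ, Tendsto (fun n => L n ω) atTop (𝓝 (Z₁ ω))) ∧
      -- `l` is the (finite) expectation of `ln ‖φ₀* (Z₁)‖`
      (∀ᵐ ω ∂μ, 0 < PosProd.traceNorm (PosProd.adj (φ₀ ω) (Z₁ ω))) ∧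
      Integrable (fun ω => Real.log (PosProd.traceNorm (PosProd.adj (φ₀ ω) (Z₁ ω)))) μ ∧
      l = ∫ ω, Real.log (PosProd.traceNorm (PosProd.adj (φ₀ ω) (Z₁ ω))) ∂μ ∧
      -- the law of large numbers, uniformly over all pairs of density matrices
      (∀ᵐ ω ∂μ, Tendsto
        (fun n : ℕ => ⨆ X ∈ PosProd.densities D, ⨆ Y ∈ PosProd.densities D,
          (((1 / (n : ℝ) : ℝ) : EReal) *
            PosProd.elog (PosProd.hsInner Y (PosProd.prodMap θ φ₀ n ω X)).re - (l : EReal)).abs)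
        atTop (𝓝 (0 : ℝ≥0∞))) ∧
      (∀ᵐ ω ∂μ, Tendsto
        (fun n : ℕ => ((1 / (n : ℝ) : ℝ) : EReal) *
          PosProd.elog (PosProd.opNorm (PosProd.prodMap θ φ₀ n ω)))
        atTop (𝓝 (l : EReal))) ∧
      (∀ᵐ ω ∂μ, Tendsto
        (fun n : ℕ => ((1 / (n : ℝ) : ℝ) : EReal) *
          PosProd.elog (PosProd.specRad (PosProd.prodMap θ φ₀ n ω)))
        atTop (𝓝 (l : EReal))) := by
  classical
  obtain ⟨Z₀, hZm, hZf, hZ⟩ :=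
    PosProd.exists_measurable_limitState hθ hD hmeas hpos h_tau h_v
  have hD' : (0 : ℝ) < D := by exact_mod_cast hD
  have hZd : ∀ ω, Z₀ ω ∈ PosProd.densities D := fun ω => ⟨(hZf ω).1.posSemidef, (hZf ω).2⟩
  have hF := PosProd.measurable_adj_apply (PosProd.measurable_superOp_apply hmeas)
  have hposF : ∀ ω, PosProd.IsPositiveMap (PosProd.adj (φ₀ ω)) := fun ω => (hpos ω).adj
  have htn : ∀ ω, PosProd.traceNorm (PosProd.adj (φ₀ ω) (Z₀ (θ ω))) =
      PosProd.rtr (PosProd.adj (φ₀ ω) (Z₀ (θ ω))) := fun ω =>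
    PosProd.traceNorm_eq_rtr (hposF ω _ (hZd _).1)
  have hbase := PosProd.ae_exists_uniform_log_rip_bound hθ hD hmeas hpos h_tau h_norm h_v
    hZm hZd hZ
  have hnd := PosProd.ae_isNondegenerate hθ.toMeasurePreserving hD hmeas hpos h_v
  have hq := hθ.toMeasurePreserving.quasiMeasurePreserving
  -- the uniform law for `Φ^(n)`, which is driven by the orbit of `θ ω`
  have hlaw : ∀ᵐ ω ∂μ, ∃ e : ℕ → ℝ, Tendsto e atTop (𝓝 0) ∧
      ∀ᶠ n in atTop, ∀ X ∈ PosProd.densities D, ∀ Y ∈ PosProd.densities D,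
        0 < PosProd.rip (PosProd.adj (PosProd.prodMap θ φ₀ n ω) Y) X ∧
          |1 / (n : ℝ) * Real.log (PosProd.rip (PosProd.adj (PosProd.prodMap θ φ₀ n ω) Y) X) -
            ∫ ω, Real.log (PosProd.rtr (PosProd.adj (φ₀ ω) (Z₀ (θ ω)))) ∂μ| ≤ e n := by
    simp only [PosProd.adj_prodMap]
    exact hq.ae hbase
  -- the eigenmatrix, with an arbitrary value at the times when it is not unique and faithful
  let IsPF : ℕ → Ω → PosProd.Mat D → Prop := fun n ω L => L ∈ PosProd.faithfulDensities D ∧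
    ∀ L', PosProd.IsLeftPerronFrobenius (PosProd.prodMap θ φ₀ n ω) L' ↔ L' = L
  let L : ℕ → Ω → PosProd.Mat D := fun n ω => Classical.epsilon (IsPF n ω)
  have hL : ∀ᵐ ω ∂μ, ∀ᶠ n in atTop, IsPF n ω (L n ω) := by
    filter_upwards [h_tau] with ω hω
    obtain ⟨N, hN⟩ := PosProd.exists_of_tau_lt_top hω
    filter_upwards [eventually_ge_atTop N] with n hn
    obtain ⟨k, rfl⟩ := Nat.exists_eq_add_of_le hn
    exact Classical.epsilon_spec (p := IsPF (N + k) ω) (PosProd.exists_isLeftPerronFrobenius_iff hD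
      (PosProd.isPositiveMap_prodMap hpos _ ω) (hN k))
  have hLPF : ∀ᵐ ω ∂μ, ∀ᶠ n in atTop,
      PosProd.IsLeftPerronFrobenius (PosProd.prodMap θ φ₀ n ω) (L n ω) :=
    hL.mono fun ω hω => hω.mono fun n hn => (hn.2 _).2 rfl
  have hint := PosProd.integrable_log_rtr_limitState hD hF hposF h_norm h_v
    (hZm.comp hθ.measurable) fun ω => hZd (θ ω)
  refine ⟨L, fun ω => Z₀ (θ ω), _, hL, hZm.comp hθ.measurable, fun ω => hZf _, ?_, ?_, ?_, rfl,
    ?_, ?_, ?_⟩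
  · filter_upwards [hLPF, hq.ae hZ, hq.ae hnd] with ω h1 h2 h3
    refine (h2.2 (fun n => L n ω) (h1.mono fun n hn => hn.1)).congr' ?_
    filter_upwards [h1] with n hn
    have h4 := (PosProd.isNondegenerate_fwd (fun k => (h3 k).2) n).rtr_pos _ hn.1
    rw [← PosProd.adj_prodMap] at h4 ⊢
    exact hn.normalize_eq h4
  · filter_upwards [hnd] with ω hω
    rw [htn]
    exact (hω 0).2.rtr_pos _ (hZd _)
  · simp only [htn]
    exact hint.2
  · simp only [htn]
    filter_upwards [hlaw] with ω ⟨e, he, h⟩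
    exact PosProd.tendsto_iSup_elog_sub_abs (Φ := fun n => PosProd.prodMap θ φ₀ n ω) he h
  · simp only [htn]
    obtain ⟨c, C, hc, hC, hcC⟩ := PosProd.opNorm_comparable hD
    filter_upwards [hlaw] with ω ⟨e, he, h⟩
    have hcC' := fun n => hcC _ (PosProd.isPositiveMap_prodMap (θ := θ) hpos n ω)
    have hX := Eventually.of_forall (f := (atTop : Filter ℕ))
      fun _ => PosProd.normalize_one_mem hD
    obtain ⟨hu, hlim⟩ := PosProd.tendsto_one_div_mul_log
      (Φ := fun n => PosProd.prodMap θ φ₀ n ω) he h hX hX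
    exact PosProd.tendsto_elog_of_comparable hc hC hu (.of_forall fun n => (hcC' n).1)
      (.of_forall fun n => (hcC' n).2) hlim
  · simp only [htn]
    filter_upwards [hlaw, hLPF] with ω ⟨e, he, h⟩ hω
    obtain ⟨hu, hlim⟩ := PosProd.tendsto_one_div_mul_log
      (Φ := fun n => PosProd.prodMap θ φ₀ n ω) he h
      (.of_forall fun _ => PosProd.normalize_one_mem hD) (hω.mono fun n hn => hn.1)
    have heq : ∀ᶠ n in atTop, PosProd.specRad (PosProd.prodMap θ φ₀ n ω) =
        D * PosProd.rip (PosProd.adj (PosProd.prodMap θ φ₀ n ω) (L n ω)) (PosProd.normalize 1) := by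
      filter_upwards [hω] with n hn
      rw [PosProd.rip_normalize_one, mul_inv_cancel_left₀ hD'.ne', hn.specRad_eq]
    exact PosProd.tendsto_elog_of_comparable hD' hD' hu (heq.mono fun n hn => hn.ge)
      (heq.mono fun n hn => hn.le) hlim
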